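/- Let $n,m\ge 0$ be integers, let $F$ be an $m\times m$-valued rational function of a complex variable $s$ (complex coefficients are allowed) with no pole at infinity, and let $$F(s)=C(sI_n-A)^{-1}B+D,\qquad R_F=\begin{pmatrix}A&B\\ C&D\end{pmatrix}$$ be a realization of $F$, where $A,B,C,D$ are complex matrices of sizes $n\times n$, $n\times m$, $m\times n$, $m\times m$. The realization is called minimal if $F$ has no realization with a smaller state dimension $n$. For Hermitian matrices, $X\succcurlyeq Y$ (respectively $X\succ Y$) means that $X-Y$ is positive semidefinite (respectively positive definite). For a Hermitian $m\times m$ matrix $T$ with $I_m\succ T\succcurlyeq 0$, a rational function $G$ with $m\times m$ matrix values is called $T$-hyper-positive, $G\in\mathcal{HP}_T$, if for every $s$ with $\operatorname{Re}s>0$, $G$ is analytic at $s$ and $$G(s)+G(s)^*\succcurlyeq T+G(s)^*\,T\,G(s).$$ For such $T$, a Hermitian $n\times n$ matrix $H\succ 0$ and an $(n+m)\times(n+m)$ matrix $R=\begin{pmatrix}A'&B'\\ C'&D'\end{pmatrix}$, partitioned as $R_F$ is, consider the inequality $$\begin{pmatrix}-H&0\\0&I_m\end{pmatrix}R+R^*\begin{pmatrix}-H&0\\0&I_m\end{pmatrix}\succcurlyeq\Gamma^*\begin{pmatrix}T&0\\0&T\end{pmatrix}\Gamma,\qquad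 \Gamma=\begin{pmatrix}C'&D'\\0&I_m\end{pmatrix}.\tag{1}$$ (i) Let $I_m\succ T\succcurlyeq 0$. If there is an $H\succ 0$ such that (1) holds for $R=R_F$, then $F\in\mathcal{HP}_T$. If the realization is minimal, the converse holds as well: if $F\in\mathcal{HP}_T$, then there is an $H\succ 0$ such that (1) holds for $R=R_F$. (ii) If (1) holds for $R=R_F$ with some $I_m\succ T\succ 0$ and $H\succ 0$, and the realization is minimal, then the $(n+m)\times(n+m)$ matrix $R_F$ is nonsingular. (iii) In the situation of (ii), $R=R_F^{-1}$ satisfies (1) with the same $T$ and the same $H$. In particular, the rational function $\hat F$ whose realization array is $R_F^{-1}$ (partitioned as $R_F$ is) belongs to the same $\mathcal{HP}_T$. -/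

import Mathlib

open Matrix
open scoped ComplexOrder

/-- An `(n+m) × (n+m)` realization array, partitioned as `[A B; C D]` with `A` of size `n × n`
and `D` of size `m × m`. -/
abbrev RealizationArray (n m : ℕ) : Type :=
  Matrix (Fin n ⊕ Fin m) (Fin n ⊕ Fin m) ℂ

/-- An `m × m`-valued rational function of one complex variable. -/
abbrev RationalMatrix (m : ℕ) : Type :=
  Matrix (Fin m) (Fin m) (RatFunc ℂ)

namespace RationalMatrix

/-- The value `F(s)` of a matrix-valued rational function, computed entrywise from reduced
fractions. -/
noncomputable def value {m : ℕ} (F : RationalMatrix m) (s : ℂ) : Matrix (Fin m) (Fin m) ℂ :=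
  Matrix.of fun i j => RatFunc.eval (RingHom.id ℂ) s (F i j)

/-- `F` is analytic at `s`: every entry is. (At a pole `s₀` of an entry, `RatFunc.eval` returns `0`
there while the entry is unbounded near `s₀`, so analyticity fails, as it should.) -/
def AnalyticAtPoint {m : ℕ} (F : RationalMatrix m) (s : ℂ) : Prop :=
  ∀ i j, AnalyticAt ℂ (fun z => F.value z i j) s

/-- `F` is `T`-hyper-positive: for all `s` in the open right half plane, `F` is analytic at `s` and
`F(s) + F(s)* ≽ T + F(s)* T F(s)`. It is used for `I ≻ T ≽ 0`. -/
def IsHyperPositive {m : ℕ} (T : Matrix (Fin m) (Fin m) ℂ) (F : RationalMatrix m) : Prop :=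
  ∀ s : ℂ, 0 < s.re → F.AnalyticAtPoint s ∧
    ((F.value s + (F.value s)ᴴ) - (T + (F.value s)ᴴ * T * F.value s)).PosSemidef

end RationalMatrix

namespace RealizationArray

/-- The rational function `C (s I - A)⁻¹ B + D` of the array `R = [A B; C D]`, computed over the
field of rational functions in `s` (where `s I - A` is invertible). -/
noncomputable def transferFunction {n m : ℕ} (R : RealizationArray n m) : RationalMatrix m :=
  (toBlocks₂₁ R).map RatFunc.C *
      (Matrix.scalar (Fin n) RatFunc.X - (toBlocks₁₁ R).map RatFunc.C)⁻¹ *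
      (toBlocks₁₂ R).map RatFunc.C +
    (toBlocks₂₂ R).map RatFunc.C

/-- `R` is a realization of `F`: `F(s) = C (s I - A)⁻¹ B + D` as rational functions. -/
def IsRealizationOf {n m : ℕ} (R : RealizationArray n m) (F : RationalMatrix m) : Prop :=
  F = transferFunction R

/-- `R` is a minimal realization of `F`: no realization of `F` has a smaller state dimension. -/
def IsMinimalRealizationOf {n m : ℕ} (R : RealizationArray n m) (F : RationalMatrix m) : Prop :=
  IsRealizationOf R F ∧
    ∀ (k : ℕ) (R' : RealizationArray k m), IsRealizationOf R' F → n ≤ k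

/-- The matrix `diag(-H, I_m)`. -/
def weight {n : ℕ} (m : ℕ) (H : Matrix (Fin n) (Fin n) ℂ) : RealizationArray n m :=
  fromBlocks (-H) 0 0 1

/-- The `2m × (n+m)` matrix `Γ = [C D; 0 I_m]`. -/
def gammaMatrix {n m : ℕ} (R : RealizationArray n m) :
    Matrix (Fin m ⊕ Fin m) (Fin n ⊕ Fin m) ℂ :=
  fromBlocks (toBlocks₂₁ R) (toBlocks₂₂ R) 0 1

/-- The quadratic matrix inequality
`diag(-H, I) R + R* diag(-H, I) ≽ Γ* diag(T, T) Γ`. -/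
def QuadraticInequality {n m : ℕ} (T : Matrix (Fin m) (Fin m) ℂ) (H : Matrix (Fin n) (Fin n) ℂ)
    (R : RealizationArray n m) : Prop :=
  ((weight m H * R + Rᴴ * weight m H) -
    (gammaMatrix R)ᴴ * fromBlocks T 0 0 T * gammaMatrix R).PosSemidef

end RealizationArray

open Filter Topology Asymptotics

/-! Write v = (x, u) and R v = (x', y). Tested on v, the matrix inequality says 2 Re x*Hx' ≤ σ(u,
y), where σ(u, y) = 2 Re u*y - y*Ty - u*Tu is a supply rate (`quadraticInequality_iff`). Both sides
are unchanged when (x, u) and (x', y) are exchanged, so the inequality passes from R to its inverse.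
If x' = s x then y = F(s)u and the left side is 2 Re(s) x*Hx ≥ 0, which is hyper-positivity.

The hard direction builds H as a required supply. The Cayley transform replaces the relation between
x and x' by the discrete step from x - x' to x + x'. The total supply of a finite trajectory
starting at rest is nonnegative (`sum_supply_nonneg`): transform the trajectory, apply
hyper-positivity on a circle inside the unit disc, and return by a discrete Parseval identity. Total
supply is thus a semidefinite inner product on trajectories; its infimum over those reaching a given
state is a quadratic form H (`exists_quotient_form`). Appending one step gives the dissipation
inequality (`exists_storage`).

Minimality enters through controllability, which makes every state reachable, and observability,
which makes H definite and R injective. Together they show that every eigenvalue of A is a pole of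
F. -/

/-! ### Hermitian forms and the inequality as a bound by a supply rate -/

theorem star_star_dotProduct_mulVec {ι : Type*} [Fintype ι] {S : Matrix ι ι ℂ}
    (hS : S.IsHermitian) (v w : ι → ℂ) :
    star (star v ⬝ᵥ S *ᵥ w) = star w ⬝ᵥ S *ᵥ v := by
  rw [star_dotProduct, star_star, star_mulVec, hS.eq, ← dotProduct_mulVec]

theorem re_star_dotProduct_mulVec_comm {ι : Type*} [Fintype ι] {S : Matrix ι ι ℂ}
    (hS : S.IsHermitian) (v w : ι → ℂ) :
    (star v ⬝ᵥ S *ᵥ w).re = (star w ⬝ᵥ S *ᵥ v).re := by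
  rw [← star_star_dotProduct_mulVec hS v w]; simp

theorem posSemidef_iff_re {ι : Type*} [Fintype ι] {S : Matrix ι ι ℂ} (hS : S.IsHermitian) :
    S.PosSemidef ↔ ∀ v : ι → ℂ, 0 ≤ (star v ⬝ᵥ S *ᵥ v).re := by
  rw [posSemidef_iff_dotProduct_mulVec]
  refine ⟨fun h v => (Complex.le_def.1 (h.2 v)).1, fun h => ⟨hS, fun v => ?_⟩⟩
  refine Complex.le_def.2 ⟨h v, ?_⟩
  have := congrArg Complex.im (star_star_dotProduct_mulVec hS v v)
  simp only [Complex.star_def, Complex.conj_im] at this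
  simp only [Complex.zero_im]
  linarith

namespace RealizationArray

variable {n m : ℕ}

theorem mulVec_eq_elim (R : RealizationArray n m) (v : Fin n ⊕ Fin m → ℂ) :
    R *ᵥ v = Sum.elim (toBlocks₁₁ R *ᵥ (v ∘ Sum.inl) + toBlocks₁₂ R *ᵥ (v ∘ Sum.inr))
      (toBlocks₂₁ R *ᵥ (v ∘ Sum.inl) + toBlocks₂₂ R *ᵥ (v ∘ Sum.inr)) := by
  conv_lhs => rw [← fromBlocks_toBlocks R, fromBlocks_mulVec]

theorem weight_isHermitian {H : Matrix (Fin n) (Fin n) ℂ} (hH : H.IsHermitian) :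
    (weight m H).IsHermitian := by
  unfold weight
  rw [isHermitian_fromBlocks_iff]
  exact ⟨hH.neg, by simp, by simp, isHermitian_one⟩

theorem quadraticMatrix_isHermitian {T : Matrix (Fin m) (Fin m) ℂ} {H : Matrix (Fin n) (Fin n) ℂ}
    (hT : T.IsHermitian) (hH : H.IsHermitian) (R : RealizationArray n m) :
    ((weight m H * R + Rᴴ * weight m H) -
      (gammaMatrix R)ᴴ * fromBlocks T 0 0 T * gammaMatrix R).IsHermitian := by
  have hW := weight_isHermitian (m := m) hH
  have hTT : (fromBlocks T 0 0 T).IsHermitian :=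
    isHermitian_fromBlocks_iff.2 ⟨hT, by simp, by simp, hT⟩
  refine IsHermitian.sub ?_ (isHermitian_conjTranspose_mul_mul _ hTT)
  unfold Matrix.IsHermitian
  rw [conjTranspose_add, conjTranspose_mul, conjTranspose_mul, conjTranspose_conjTranspose, hW.eq,
    add_comm]

theorem quadraticMatrix_form {T : Matrix (Fin m) (Fin m) ℂ} {H : Matrix (Fin n) (Fin n) ℂ}
    (hH : H.IsHermitian) (R : RealizationArray n m) (v : Fin n ⊕ Fin m → ℂ) :
    (star v ⬝ᵥ ((weight m H * R + Rᴴ * weight m H) -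
      (gammaMatrix R)ᴴ * fromBlocks T 0 0 T * gammaMatrix R) *ᵥ v).re =
    2 * (star (v ∘ Sum.inr) ⬝ᵥ ((R *ᵥ v) ∘ Sum.inr)).re
      - 2 * (star (v ∘ Sum.inl) ⬝ᵥ H *ᵥ ((R *ᵥ v) ∘ Sum.inl)).re
      - (star ((R *ᵥ v) ∘ Sum.inr) ⬝ᵥ T *ᵥ ((R *ᵥ v) ∘ Sum.inr)).re
      - (star (v ∘ Sum.inr) ⬝ᵥ T *ᵥ (v ∘ Sum.inr)).re := by
  have hW := weight_isHermitian (m := m) hH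
  have e1 : star v ⬝ᵥ (Rᴴ * weight m H) *ᵥ v = star (R *ᵥ v) ⬝ᵥ weight m H *ᵥ v := by
    rw [star_mulVec, ← mulVec_mulVec, ← dotProduct_mulVec]
  have e2 : star v ⬝ᵥ ((gammaMatrix R)ᴴ * fromBlocks T 0 0 T * gammaMatrix R) *ᵥ v =
      star (gammaMatrix R *ᵥ v) ⬝ᵥ fromBlocks T 0 0 T *ᵥ (gammaMatrix R *ᵥ v) := by
    rw [star_mulVec, ← mulVec_mulVec, ← mulVec_mulVec, ← dotProduct_mulVec]
  have e3 : gammaMatrix R *ᵥ v = Sum.elim ((R *ᵥ v) ∘ Sum.inr) (v ∘ Sum.inr) := by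
    rw [gammaMatrix, fromBlocks_mulVec, mulVec_eq_elim R v]
    simp
  have e4 : star v ⬝ᵥ weight m H *ᵥ (R *ᵥ v) =
      star (v ∘ Sum.inr) ⬝ᵥ ((R *ᵥ v) ∘ Sum.inr)
        - star (v ∘ Sum.inl) ⬝ᵥ H *ᵥ ((R *ᵥ v) ∘ Sum.inl) := by
    conv_lhs => rw [weight, fromBlocks_mulVec]
    rw [← Sum.elim_comp_inl_inr (star v), sumElim_dotProduct_sumElim]
    simp [neg_mulVec, sub_eq_neg_add]
    rfl
  have e5 : star (gammaMatrix R *ᵥ v) ⬝ᵥ fromBlocks T 0 0 T *ᵥ (gammaMatrix R *ᵥ v) =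
      star ((R *ᵥ v) ∘ Sum.inr) ⬝ᵥ T *ᵥ ((R *ᵥ v) ∘ Sum.inr) +
        star (v ∘ Sum.inr) ⬝ᵥ T *ᵥ (v ∘ Sum.inr) := by
    rw [e3, fromBlocks_mulVec, Function.star_sumElim, sumElim_dotProduct_sumElim]
    simp
  rw [sub_mulVec, add_mulVec, dotProduct_sub, dotProduct_add, e1, e2, e5, Complex.sub_re,
    Complex.add_re, re_star_dotProduct_mulVec_comm hW (R *ᵥ v) v, ← mulVec_mulVec, e4]
  simp only [Complex.sub_re, Complex.add_re]
  ring

theorem quadraticInequality_iff {T : Matrix (Fin m) (Fin m) ℂ} {H : Matrix (Fin n) (Fin n) ℂ}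
    (hT : T.IsHermitian) (hH : H.IsHermitian) (R : RealizationArray n m) :
    QuadraticInequality T H R ↔ ∀ v : Fin n ⊕ Fin m → ℂ,
      2 * (star (v ∘ Sum.inl) ⬝ᵥ H *ᵥ ((R *ᵥ v) ∘ Sum.inl)).re
      + (star ((R *ᵥ v) ∘ Sum.inr) ⬝ᵥ T *ᵥ ((R *ᵥ v) ∘ Sum.inr)).re
      + (star (v ∘ Sum.inr) ⬝ᵥ T *ᵥ (v ∘ Sum.inr)).re ≤
      2 * (star (v ∘ Sum.inr) ⬝ᵥ ((R *ᵥ v) ∘ Sum.inr)).re := by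
  rw [QuadraticInequality, posSemidef_iff_re (quadraticMatrix_isHermitian hT hH R)]
  refine forall_congr' fun v => ?_
  rw [quadraticMatrix_form hH]
  constructor <;> intro h <;> linarith

theorem hyperPositive_posSemidef_iff {T : Matrix (Fin m) (Fin m) ℂ} (hT : T.IsHermitian)
    (G : Matrix (Fin m) (Fin m) ℂ) :
    ((G + Gᴴ) - (T + Gᴴ * T * G)).PosSemidef ↔ ∀ u : Fin m → ℂ,
      (star (G *ᵥ u) ⬝ᵥ T *ᵥ (G *ᵥ u)).re + (star u ⬝ᵥ T *ᵥ u).re ≤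
        2 * (star u ⬝ᵥ G *ᵥ u).re := by
  have hS : ((G + Gᴴ) - (T + Gᴴ * T * G)).IsHermitian := by
    refine IsHermitian.sub (isHermitian_add_transpose_self G)
      (hT.add (isHermitian_conjTranspose_mul_mul _ hT))
  rw [posSemidef_iff_re hS]
  refine forall_congr' fun u => ?_
  have e1 : star u ⬝ᵥ Gᴴ *ᵥ u = star (star u ⬝ᵥ G *ᵥ u) := by
    rw [star_dotProduct, star_mulVec, conjTranspose_conjTranspose, ← dotProduct_mulVec]
  have e2 : star u ⬝ᵥ (Gᴴ * T * G) *ᵥ u = star (G *ᵥ u) ⬝ᵥ T *ᵥ (G *ᵥ u) := by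
    rw [star_mulVec, ← mulVec_mulVec, ← mulVec_mulVec, ← dotProduct_mulVec]
  rw [sub_mulVec, add_mulVec, add_mulVec, dotProduct_sub, dotProduct_add, dotProduct_add, e1, e2]
  simp only [Complex.sub_re, Complex.add_re, Complex.star_def, Complex.conj_re]
  constructor <;> intro h <;> linarith

end RealizationArray

/-! ### Values of the transfer function off the spectrum of A -/

/-- `RatFunc.eval` uses the reduced fraction; its denominator divides q, so it does not vanish at s
either. -/
theorem RatFunc.eval_algebraMap_div {K : Type*} [Field K] (p q : Polynomial K) (s : K)
    (hq : q.eval s ≠ 0) :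
    RatFunc.eval (RingHom.id K) s (algebraMap _ (RatFunc K) p / algebraMap _ (RatFunc K) q) =
      p.eval s / q.eval s := by
  have hq0 : q ≠ 0 := by rintro rfl; simp at hq
  set x := algebraMap _ (RatFunc K) p / algebraMap _ (RatFunc K) q with hx
  have hd : x.denom.eval s ≠ 0 := fun h => hq (Polynomial.eval_eq_zero_of_dvd_of_eval_eq_zero
    (RatFunc.denom_div_dvd p q) h)
  have h := congrArg (Polynomial.eval s) ((RatFunc.num_mul_eq_mul_denom_iff hq0).2 hx)
  rw [Polynomial.eval_mul, Polynomial.eval_mul] at h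
  rwa [RatFunc.eval, Polynomial.eval₂_id, Polynomial.eval₂_id, div_eq_div_iff hd hq]

namespace RealizationArray
variable {n m : ℕ}

theorem charmatrix_map_algebraMap (A : Matrix (Fin n) (Fin n) ℂ) :
    (charmatrix A).map (algebraMap (Polynomial ℂ) (RatFunc ℂ)) =
      Matrix.scalar (Fin n) RatFunc.X - A.map RatFunc.C := by
  ext i j
  by_cases h : i = j
  · subst h; simp
  · simp [h]

theorem det_scalar_sub_eq (A : Matrix (Fin n) (Fin n) ℂ) :
    (Matrix.scalar (Fin n) RatFunc.X - A.map RatFunc.C).det =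
      algebraMap (Polynomial ℂ) (RatFunc ℂ) A.charpoly := by
  rw [← charmatrix_map_algebraMap, charpoly, RingHom.map_det]
  rfl

theorem isUnit_scalar_sub (A : Matrix (Fin n) (Fin n) ℂ) :
    IsUnit (Matrix.scalar (Fin n) RatFunc.X - A.map RatFunc.C).det := by
  rw [det_scalar_sub_eq, isUnit_iff_ne_zero]
  exact RatFunc.algebraMap_ne_zero (charpoly_monic A).ne_zero

/-- The numerator of the transfer function over the characteristic polynomial of `A`. -/
noncomputable def numerator (R : RealizationArray n m) :
    Matrix (Fin m) (Fin m) (Polynomial ℂ) :=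
  (toBlocks₂₁ R).map Polynomial.C * (charmatrix (toBlocks₁₁ R)).adjugate *
      (toBlocks₁₂ R).map Polynomial.C +
    (toBlocks₁₁ R).charpoly • (toBlocks₂₂ R).map Polynomial.C

theorem transferFunction_apply (R : RealizationArray n m) (i j : Fin m) :
    transferFunction R i j = algebraMap _ (RatFunc ℂ) (numerator R i j) /
      algebraMap _ (RatFunc ℂ) (toBlocks₁₁ R).charpoly := by
  have h0 : algebraMap _ (RatFunc ℂ) (toBlocks₁₁ R).charpoly ≠ 0 :=
    RatFunc.algebraMap_ne_zero (charpoly_monic _).ne_zero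
  have hadj : (Matrix.scalar (Fin n) RatFunc.X - (toBlocks₁₁ R).map RatFunc.C).adjugate =
      (charmatrix (toBlocks₁₁ R)).adjugate.map (algebraMap (Polynomial ℂ) (RatFunc ℂ)) := by
    rw [← charmatrix_map_algebraMap]
    exact (RingHom.map_adjugate (algebraMap (Polynomial ℂ) (RatFunc ℂ)) _).symm
  have hC : ∀ {k l : ℕ} (M : Matrix (Fin k) (Fin l) ℂ), M.map RatFunc.C =
      (M.map Polynomial.C).map (algebraMap (Polynomial ℂ) (RatFunc ℂ)) := by
    intro k l M; ext; simp
  have key : transferFunction R = (algebraMap _ (RatFunc ℂ) (toBlocks₁₁ R).charpoly)⁻¹ •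
      (numerator R).map (algebraMap (Polynomial ℂ) (RatFunc ℂ)) := by
    rw [transferFunction, Matrix.inv_def, det_scalar_sub_eq, hadj, hC, hC, hC, numerator,
      Ring.inverse_eq_inv', Matrix.map_add _ (map_add _), Matrix.map_mul, Matrix.map_mul, smul_add,
      Matrix.mul_smul, Matrix.smul_mul]
    congr 1
    ext i j
    simp only [Matrix.smul_apply, Matrix.map_apply, smul_eq_mul, map_mul]
    field_simp
  rw [key]
  simp [div_eq_inv_mul]

theorem eval_charpoly (A : Matrix (Fin n) (Fin n) ℂ) (s : ℂ) :
    A.charpoly.eval s = (s • (1 : Matrix (Fin n) (Fin n) ℂ) - A).det := by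
  rw [Matrix.eval_charpoly]
  congr 2
  ext i j
  simp [Matrix.scalar_apply, Matrix.diagonal_apply, Matrix.one_apply]

theorem value_transferFunction_apply (R : RealizationArray n m) {s : ℂ}
    (hs : (toBlocks₁₁ R).charpoly.eval s ≠ 0) (i j : Fin m) :
    (transferFunction R).value s i j =
      (numerator R i j).eval s / (toBlocks₁₁ R).charpoly.eval s := by
  rw [RationalMatrix.value, Matrix.of_apply, transferFunction_apply,
    RatFunc.eval_algebraMap_div _ _ _ hs]

theorem value_transferFunction (R : RealizationArray n m) {s : ℂ}
    (hs : (toBlocks₁₁ R).charpoly.eval s ≠ 0) :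
    (transferFunction R).value s = toBlocks₂₁ R * (s • 1 - toBlocks₁₁ R)⁻¹ * toBlocks₁₂ R +
      toBlocks₂₂ R := by
  have hadj : (s • 1 - toBlocks₁₁ R).adjugate =
      (charmatrix (toBlocks₁₁ R)).adjugate.map (Polynomial.eval s) := by
    have := RingHom.map_adjugate (Polynomial.evalRingHom s) (charmatrix (toBlocks₁₁ R))
    simp only [RingHom.mapMatrix_apply, Polynomial.coe_evalRingHom] at this
    rw [this]
    congr 1
    ext i j
    by_cases h : i = j
    · subst h; simp
    · simp [h]
  have hC : ∀ {k l : ℕ} (M : Matrix (Fin k) (Fin l) ℂ),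
      (M.map Polynomial.C).map (Polynomial.evalRingHom s) = M := by
    intro k l M; ext; simp
  have hnum : (numerator R).map (Polynomial.evalRingHom s) =
      toBlocks₂₁ R * (s • 1 - toBlocks₁₁ R).adjugate * toBlocks₁₂ R +
        (toBlocks₁₁ R).charpoly.eval s • toBlocks₂₂ R := by
    rw [numerator, Matrix.map_add _ (map_add _), Matrix.map_mul, Matrix.map_mul, hC, hC, hadj]
    congr 1
    ext i j
    simp
  ext i j
  rw [value_transferFunction_apply R hs]
  have := congrFun (congrFun hnum i) j
  simp only [Matrix.map_apply, Polynomial.coe_evalRingHom] at this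
  rw [this, Matrix.inv_def, ← eval_charpoly, Ring.inverse_eq_inv', Matrix.mul_smul, Matrix.smul_mul]
  simp only [Matrix.add_apply, Matrix.smul_apply, smul_eq_mul]
  field_simp

theorem analyticAtPoint_transferFunction (R : RealizationArray n m) {s : ℂ}
    (hs : (toBlocks₁₁ R).charpoly.eval s ≠ 0) :
    (transferFunction R).AnalyticAtPoint s := by
  intro i j
  have hp : ∀ p : Polynomial ℂ, AnalyticAt ℂ (fun z => p.eval z) s := fun p => by
    simpa using AnalyticAt.aeval_polynomial (analyticAt_id (𝕜 := ℂ) (z := s)) p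
  refine ((hp _).div (hp _) hs).congr (f := fun z => (numerator R i j).eval z /
    (toBlocks₁₁ R).charpoly.eval z) ?_
  have : ∀ᶠ z in nhds s, (toBlocks₁₁ R).charpoly.eval z ≠ 0 :=
    (Polynomial.continuous _).continuousAt.eventually_ne hs
  filter_upwards [this] with z hz
  rw [value_transferFunction_apply R hz]

end RealizationArray

/-! ### Minimality implies controllability and observability -/

theorem Matrix.inv_mul_eq_mul_inv_of_intertwine {K : Type*} [Field K] {k n : ℕ}
    {M : Matrix (Fin n) (Fin n) K} {N : Matrix (Fin k) (Fin k) K} {P : Matrix (Fin n) (Fin k) K}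
    (hM : IsUnit M.det) (hN : IsUnit N.det) (h : M * P = P * N) : M⁻¹ * P = P * N⁻¹ := by
  calc M⁻¹ * P = M⁻¹ * (P * N) * N⁻¹ := by
        rw [Matrix.mul_assoc, Matrix.mul_assoc, Matrix.mul_nonsing_inv _ hN, Matrix.mul_one]
    _ = P * N⁻¹ := by rw [← h, Matrix.nonsing_inv_mul_cancel_left _ _ hM]

namespace RealizationArray
variable {n m : ℕ}

theorem scalar_sub_intertwine {k : ℕ} {A : Matrix (Fin n) (Fin n) ℂ} {A' : Matrix (Fin k) (Fin k) ℂ}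
    {P : Matrix (Fin n) (Fin k) ℂ} (h : A * P = P * A') :
    (Matrix.scalar (Fin n) RatFunc.X - A.map RatFunc.C)⁻¹ * P.map RatFunc.C =
      P.map RatFunc.C * (Matrix.scalar (Fin k) RatFunc.X - A'.map RatFunc.C)⁻¹ := by
  refine Matrix.inv_mul_eq_mul_inv_of_intertwine (isUnit_scalar_sub A) (isUnit_scalar_sub A') ?_
  rw [Matrix.sub_mul, Matrix.mul_sub, ← Matrix.map_mul, ← Matrix.map_mul, h]
  congr 1
  ext i j
  simp [Matrix.scalar_apply, mul_comm]

/-- P may be rectangular: it serves both as the inclusion of an invariant subspace and as the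
projection onto a quotient. -/
theorem transferFunction_eq_of_intertwine {k : ℕ} {A : Matrix (Fin n) (Fin n) ℂ}
    {B : Matrix (Fin n) (Fin m) ℂ} {C : Matrix (Fin m) (Fin n) ℂ} {D : Matrix (Fin m) (Fin m) ℂ}
    {A' : Matrix (Fin k) (Fin k) ℂ} {B' : Matrix (Fin k) (Fin m) ℂ}
    {C' : Matrix (Fin m) (Fin k) ℂ} {P : Matrix (Fin n) (Fin k) ℂ}
    (hA : A * P = P * A') (hB : B = P * B') (hC : C' = C * P) :
    transferFunction (fromBlocks A B C D) = transferFunction (fromBlocks A' B' C' D) := by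
  simp only [transferFunction, toBlocks_fromBlocks₁₁, toBlocks_fromBlocks₁₂,
    toBlocks_fromBlocks₂₁, toBlocks_fromBlocks₂₂]
  rw [hB, hC, Matrix.map_mul, Matrix.map_mul, ← Matrix.mul_assoc, Matrix.mul_assoc (C.map _),
    scalar_sub_intertwine hA, ← Matrix.mul_assoc]

/-- `(A, B)` is controllable: no proper `A`-invariant subspace contains the range of `B`. -/
def IsControllable (A : Matrix (Fin n) (Fin n) ℂ) (B : Matrix (Fin n) (Fin m) ℂ) : Prop :=
  ∀ W : Submodule ℂ (Fin n → ℂ), (∀ x ∈ W, A *ᵥ x ∈ W) → (∀ u, B *ᵥ u ∈ W) → W = ⊤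

/-- `(C, A)` is observable: no nonzero `A`-invariant subspace lies in the kernel of `C`. -/
def IsObservable (C : Matrix (Fin m) (Fin n) ℂ) (A : Matrix (Fin n) (Fin n) ℂ) : Prop :=
  ∀ W : Submodule ℂ (Fin n → ℂ), (∀ x ∈ W, A *ᵥ x ∈ W) → (∀ x ∈ W, C *ᵥ x = 0) → W = ⊥

/-- Restricting the system to a proper invariant W containing the range of B would give a smaller
realization. -/
theorem IsMinimalRealizationOf.isControllable {F : RationalMatrix m}
    {A : Matrix (Fin n) (Fin n) ℂ} {B : Matrix (Fin n) (Fin m) ℂ} {C : Matrix (Fin m) (Fin n) ℂ}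
    {D : Matrix (Fin m) (Fin m) ℂ} (h : IsMinimalRealizationOf (fromBlocks A B C D) F) :
    IsControllable A B := by
  intro W hA hB
  by_contra hW
  have hlt : Module.finrank ℂ W < n := by
    simpa using Submodule.finrank_lt hW
  let b := Module.finBasis ℂ W
  let e := Pi.basisFun ℂ (Fin n)
  let f := Pi.basisFun ℂ (Fin m)
  let a' : W →ₗ[ℂ] W := (toLin' A).restrict (fun x hx => by simpa using hA x hx)
  let b' : (Fin m → ℂ) →ₗ[ℂ] W := (toLin' B).codRestrict W (fun u => by simpa using hB u)
  refine absurd (h.2 _ (fromBlocks (LinearMap.toMatrix b b a') (LinearMap.toMatrix f b b')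
    (C * LinearMap.toMatrix b e W.subtype) D) ?_) (not_le.2 hlt)
  rw [IsRealizationOf, h.1]
  have eA : A = LinearMap.toMatrix e e (toLin' A) := (LinearMap.toMatrix'_toLin' A).symm
  have eB : B = LinearMap.toMatrix f e (toLin' B) := (LinearMap.toMatrix'_toLin' B).symm
  refine transferFunction_eq_of_intertwine (P := LinearMap.toMatrix b e W.subtype) ?_ ?_ rfl
  · conv_lhs => rw [eA]
    rw [← LinearMap.toMatrix_comp, ← LinearMap.toMatrix_comp]
    rfl
  · conv_lhs => rw [eB]
    rw [← LinearMap.toMatrix_comp]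
    rfl

/-- Dually, a nonzero invariant W inside the kernel of C can be divided out. -/
theorem IsMinimalRealizationOf.isObservable {F : RationalMatrix m}
    {A : Matrix (Fin n) (Fin n) ℂ} {B : Matrix (Fin n) (Fin m) ℂ} {C : Matrix (Fin m) (Fin n) ℂ}
    {D : Matrix (Fin m) (Fin m) ℂ} (h : IsMinimalRealizationOf (fromBlocks A B C D) F) :
    IsObservable C A := by
  intro W hA hC
  by_contra hW
  have hlt : Module.finrank ℂ ((Fin n → ℂ) ⧸ W) < n := by
    have h1 := Submodule.finrank_quotient_add_finrank W
    have h2 := Submodule.one_le_finrank_iff.2 hW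
    simp only [Module.finrank_fin_fun] at h1
    omega
  let b := Module.finBasis ℂ ((Fin n → ℂ) ⧸ W)
  let e := Pi.basisFun ℂ (Fin n)
  let f := Pi.basisFun ℂ (Fin m)
  let a' := W.mapQ W (toLin' A) (fun x hx => by simpa using hA x hx)
  let c' := W.liftQ (toLin' C) (fun x hx => by simpa using hC x hx)
  refine absurd (h.2 _ (fromBlocks (LinearMap.toMatrix b b a') (LinearMap.toMatrix e b W.mkQ * B)
    (LinearMap.toMatrix b f c') D) ?_) (not_le.2 hlt)
  rw [IsRealizationOf, h.1]
  have eA : A = LinearMap.toMatrix e e (toLin' A) := (LinearMap.toMatrix'_toLin' A).symm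
  have eC : C = LinearMap.toMatrix e f (toLin' C) := (LinearMap.toMatrix'_toLin' C).symm
  refine (transferFunction_eq_of_intertwine (P := LinearMap.toMatrix e b W.mkQ) ?_ rfl ?_).symm
  · conv_rhs => rw [eA]
    rw [← LinearMap.toMatrix_comp, ← LinearMap.toMatrix_comp]
    rfl
  · conv_lhs => rw [eC]
    rw [← LinearMap.toMatrix_comp]
    rfl

end RealizationArray

/-! ### The quotient of a semidefinite form -/

/-- H is the squared quotient seminorm, the infimum of ‖f‖² over Φ f = x. It is quadratic because,
in the completion, it is the squared norm of the projection of any lift of x onto the orthogonal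
complement of ker Φ. The infimum need not be attained, hence the ε. -/
theorem exists_quotient_form {n : ℕ} {E : Type*} [SeminormedAddCommGroup E]
    [InnerProductSpace ℂ E] (Φ : E →ₗ[ℂ] (Fin n → ℂ)) (hΦ : Function.Surjective Φ) :
    ∃ H : Matrix (Fin n) (Fin n) ℂ, H.PosSemidef ∧
      (∀ f, (star (Φ f) ⬝ᵥ H *ᵥ Φ f).re ≤ ‖f‖ ^ 2) ∧
      ∀ x, ∀ ε > 0, ∃ f, Φ f = x ∧ ‖f‖ ^ 2 < (star x ⬝ᵥ H *ᵥ x).re + ε := by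
  obtain ⟨σ, hσ⟩ := Φ.exists_rightInverse_of_surjective (LinearMap.range_eq_top.2 hΦ)
  have hσ' : ∀ x, Φ (σ x) = x := fun x => LinearMap.congr_fun hσ x
  let L : E →ₗ[ℂ] UniformSpace.Completion E :=
    (UniformSpace.Completion.toComplₗᵢ (𝕜 := ℂ) (E := E)).toLinearMap
  have hL : ∀ f, ‖L f‖ = ‖f‖ := fun f => UniformSpace.Completion.norm_coe f
  let M : Submodule ℂ (UniformSpace.Completion E) := ((LinearMap.ker Φ).map L).topologicalClosure
  have : CompleteSpace M := (Submodule.isClosed_topologicalClosure _).completeSpace_coe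
  let Q : UniformSpace.Completion E →L[ℂ] UniformSpace.Completion E := Mᗮ.starProjection
  let ψ : (Fin n → ℂ) →ₗ[ℂ] UniformSpace.Completion E := Q.toLinearMap ∘ₗ L ∘ₗ σ
  let v : Fin n → UniformSpace.Completion E := fun i => ψ (Pi.single i 1)
  have hψ : ∀ x, ψ x = ∑ i, x i • v i := fun x => by
    conv_lhs => rw [pi_eq_sum_univ' x]
    simp only [map_sum, map_smul, v]
  have hform : ∀ x, (star x ⬝ᵥ gram ℂ v *ᵥ x).re = ‖ψ x‖ ^ 2 := fun x => by
    rw [star_dotProduct_gram_mulVec, ← hψ, inner_self_eq_norm_sq_to_K]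
    norm_cast
  have hQM : ∀ y ∈ M, Q y = 0 := fun y hy =>
    (Submodule.starProjection_apply_eq_zero_iff _).2 (Submodule.le_orthogonal_orthogonal _ hy)
  refine ⟨gram ℂ v, posSemidef_gram ℂ v, fun f => ?_, fun x ε hε => ?_⟩
  · rw [hform]
    -- The choice of lift is immaterial: σ (Φ f) and f differ by an element of ker Φ, which Q kills.
    have h1 : ψ (Φ f) = Q (L f) := by
      have : Q (L (σ (Φ f) - f)) = 0 := hQM _ (Submodule.le_topologicalClosure _
        (Submodule.mem_map_of_mem (by simp [hσ'])))
      rw [map_sub, map_sub, sub_eq_zero] at this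
      exact this
    rw [h1, ← hL f]
    have := Submodule.norm_starProjection_apply_le Mᗮ (L f)
    gcongr
  -- The component of the lift along M is approximated by g in ker Φ. Subtracting g leaves ψ x plus
  -- an orthogonal error of norm below √ε.
  · have hmem : L (σ x) - ψ x ∈ M := by
      have h2 : M.starProjection (L (σ x)) = L (σ x) - ψ x := by
        rw [eq_sub_iff_add_eq]
        exact Submodule.starProjection_add_starProjection_orthogonal (K := M) (L (σ x))
      rw [← h2]
      exact Submodule.starProjection_apply_mem _ _
    have hδ : 0 < Real.sqrt ε := Real.sqrt_pos.2 hε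
    obtain ⟨y, hy, hyd⟩ := Metric.mem_closure_iff.1 hmem _ hδ
    obtain ⟨g, hg, rfl⟩ := hy
    refine ⟨σ x - g, ?_, ?_⟩
    · rw [map_sub, hσ', LinearMap.mem_ker.1 hg, sub_zero]
    · rw [hform, ← hL, map_sub]
      have e : L (σ x) - L g = ψ x + (L (σ x) - ψ x - L g) := by abel
      have hort : inner ℂ (ψ x) (L (σ x) - ψ x - L g) = 0 := by
        refine Submodule.inner_left_of_mem_orthogonal (K := M) ?_ (Submodule.starProjection_apply_mem _ _)
        exact M.sub_mem hmem (Submodule.le_topologicalClosure _ (Submodule.mem_map_of_mem hg))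
      rw [e, sq, norm_add_sq_eq_norm_sq_add_norm_sq_of_inner_eq_zero _ _ hort, ← sq, ← sq]
      have h3 : ‖L (σ x) - ψ x - L g‖ < Real.sqrt ε := by rwa [← dist_eq_norm]
      have h4 := Real.sq_sqrt hε.le
      have h5 := norm_nonneg (L (σ x) - ψ x - L g)
      nlinarith

/-! ### Decay of powers and Parseval at roots of unity -/

theorem tendsto_pow_mul_norm_pow_of_spectralRadius_le_one {𝔸 : Type*} [NormedRing 𝔸]
    [NormedAlgebra ℂ 𝔸] [CompleteSpace 𝔸] {a : 𝔸} (ha : spectralRadius ℂ a ≤ 1) {ρ : ℝ}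
    (h0 : 0 < ρ) (h1 : ρ < 1) : Tendsto (fun k : ℕ => ρ ^ k * ‖a ^ k‖) atTop (𝓝 0) := by
  -- With r = √ρ, Gelfand's formula gives ‖a^k‖ ≤ r^(-k) eventually, and ρ^k r^(-k) = r^k.
  set r : ℝ := Real.sqrt ρ with hr
  have hr0 : 0 < r := Real.sqrt_pos.2 h0
  have hrr : r * r = ρ := Real.mul_self_sqrt h0.le
  have hr1 : r < 1 := by nlinarith
  have hlt : spectralRadius ℂ a < ENNReal.ofReal r⁻¹ :=
    ha.trans_lt (by rw [ENNReal.one_lt_ofReal]; exact (one_lt_inv₀ hr0).2 hr1)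
  have hev := (spectrum.pow_norm_pow_one_div_tendsto_nhds_spectralRadius a).eventually_lt_const hlt
  refine squeeze_zero' (Eventually.of_forall fun k => by positivity) ?_
    (tendsto_pow_atTop_nhds_zero_of_lt_one hr0.le hr1)
  filter_upwards [hev, eventually_gt_atTop 0] with k hk hk0
  rw [ENNReal.ofReal_lt_ofReal_iff (by positivity)] at hk
  have h2 : ‖a ^ k‖ ≤ r⁻¹ ^ k := by
    have h3 := pow_le_pow_left₀ (by positivity) hk.le k
    rwa [← Real.rpow_natCast, ← Real.rpow_mul (norm_nonneg _), one_div_mul_cancel (by positivity),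
      Real.rpow_one] at h3
  calc ρ ^ k * ‖a ^ k‖ ≤ ρ ^ k * r⁻¹ ^ k := by gcongr
    _ = r ^ k := by rw [← mul_pow, ← hrr]; congr 1; field_simp

theorem Matrix.tendsto_smul_pow_mulVec {n : ℕ} {M : Matrix (Fin n) (Fin n) ℂ}
    (hM : ∀ μ : ℂ, 1 < ‖μ‖ → (μ • (1 : Matrix (Fin n) (Fin n) ℂ) - M).det ≠ 0) {ρ : ℝ}
    (h0 : 0 < ρ) (h1 : ρ < 1) (η : Fin n → ℂ) :
    Tendsto (fun k : ℕ => ρ ^ k * ‖(M ^ k) *ᵥ η‖) atTop (𝓝 0) := by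
  let _ : NormedRing (Matrix (Fin n) (Fin n) ℂ) := Matrix.linftyOpNormedRing
  let _ : NormedAlgebra ℂ (Matrix (Fin n) (Fin n) ℂ) := Matrix.linftyOpNormedAlgebra
  have : CompleteSpace (Matrix (Fin n) (Fin n) ℂ) := FiniteDimensional.complete ℂ _
  have hs : spectralRadius ℂ M ≤ 1 := by
    refine iSup₂_le fun μ hμ => ?_
    by_contra hlt
    rw [not_le] at hlt
    have hμ1 : 1 < ‖μ‖ := by
      rw [← coe_nnnorm]; exact_mod_cast hlt
    apply hμ
    rw [spectrum.mem_resolventSet_iff, Algebra.algebraMap_eq_smul_one, Matrix.isUnit_iff_isUnit_det]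
    exact isUnit_iff_ne_zero.2 (hM μ hμ1)
  have h := (tendsto_pow_mul_norm_pow_of_spectralRadius_le_one hs h0 h1).mul_const ‖η‖
  rw [zero_mul] at h
  refine squeeze_zero (fun k => by positivity) (fun k => ?_) h
  rw [mul_assoc]
  gcongr
  exact Matrix.linfty_opNorm_mulVec _ _

theorem sum_primitiveRoot_pow {P : ℕ} {ω : ℂ} (hω : IsPrimitiveRoot ω P) {t t' : ℕ} (ht : t < P)
    (ht' : t' < P) :
    ∑ j ∈ Finset.range P, (star (ω ^ j)) ^ t * (ω ^ j) ^ t' = if t = t' then (P : ℂ) else 0 := by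
  have hP : P ≠ 0 := by omega
  have hn : star ω * ω = 1 := by
    rw [Complex.star_def, ← Complex.normSq_eq_conj_mul_self, Complex.normSq_eq_norm_sq,
      hω.norm'_eq_one hP]
    simp
  have e : ∀ j, (star (ω ^ j)) ^ t * (ω ^ j) ^ t' = ((star ω) ^ t * ω ^ t') ^ j := fun j => by
    rw [star_pow, mul_pow, ← pow_mul, ← pow_mul, ← pow_mul, ← pow_mul, mul_comm j t, mul_comm j t']
  simp only [e]
  split_ifs with h
  · subst h
    simp only [← mul_pow, hn, one_pow]
    simp
  · have h1 : (star ω) ^ t * ω ^ t' ≠ 1 := fun h1 => h (hω.pow_inj ht ht' (by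
      calc ω ^ t = ω ^ t * ((star ω) ^ t * ω ^ t') := by rw [h1, mul_one]
        _ = (star ω * ω) ^ t * ω ^ t' := by ring
        _ = ω ^ t' := by rw [hn, one_pow, one_mul]))
    have h2 : ((star ω) ^ t * ω ^ t') ^ P = 1 := by
      rw [mul_pow, ← pow_mul, ← pow_mul, mul_comm t, mul_comm t', pow_mul, pow_mul, ← star_pow,
        hω.pow_eq_one]
      simp
    rw [geom_sum_eq h1, h2, sub_self, zero_div]

theorem star_dotProduct_mulVec_sum {ι : Type*} [Fintype ι] (S : Matrix ι ι ℂ) (b : ℕ → ι → ℂ)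
    (P : ℕ) (z : ℂ) :
    star (∑ t ∈ Finset.range P, z ^ t • b t) ⬝ᵥ S *ᵥ (∑ t ∈ Finset.range P, z ^ t • b t) =
      ∑ t ∈ Finset.range P, ∑ t' ∈ Finset.range P,
        (star z ^ t * z ^ t') * (star (b t) ⬝ᵥ S *ᵥ b t') := by
  rw [star_sum, sum_dotProduct]
  refine Finset.sum_congr rfl fun t _ => ?_
  rw [mulVec_sum, dotProduct_sum]
  refine Finset.sum_congr rfl fun t' _ => ?_
  rw [star_smul, smul_dotProduct, mulVec_smul, dotProduct_smul, star_pow, smul_smul, smul_eq_mul]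

/-- Parseval's identity for the values of a polynomial at the `P`-th roots of unity, scaled by
`ρ`. -/
theorem sum_roots_form {ι : Type*} [Fintype ι] (S : Matrix ι ι ℂ) (b : ℕ → ι → ℂ) {P : ℕ} {ω : ℂ}
    (hω : IsPrimitiveRoot ω P) (ρ : ℝ) :
    ∑ j ∈ Finset.range P, star (∑ t ∈ Finset.range P, (ρ * ω ^ j) ^ t • b t) ⬝ᵥ
        S *ᵥ (∑ t ∈ Finset.range P, (ρ * ω ^ j : ℂ) ^ t • b t) =
      P * ∑ t ∈ Finset.range P, ((ρ ^ 2) ^ t : ℝ) * (star (b t) ⬝ᵥ S *ᵥ b t) := by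
  simp only [star_dotProduct_mulVec_sum]
  rw [Finset.sum_comm, Finset.mul_sum]
  refine Finset.sum_congr rfl fun t ht => ?_
  rw [Finset.sum_comm, Finset.sum_eq_single t]
  · rw [← Finset.sum_mul]
    have : ∀ j, star (ρ * ω ^ j : ℂ) ^ t * (ρ * ω ^ j) ^ t =
        ((ρ ^ 2) ^ t : ℝ) * ((star (ω ^ j)) ^ t * (ω ^ j) ^ t) := fun j => by
      simp only [star_mul', mul_pow, Complex.star_def, Complex.conj_ofReal]
      push_cast
      ring
    simp only [this]
    rw [← Finset.mul_sum, sum_primitiveRoot_pow hω (Finset.mem_range.1 ht) (Finset.mem_range.1 ht),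
      if_pos rfl]
    ring
  · intro t' ht' hne
    rw [← Finset.sum_mul]
    have : ∀ j, star (ρ * ω ^ j : ℂ) ^ t * (ρ * ω ^ j) ^ t' =
        (ρ ^ t * ρ ^ t') * ((star (ω ^ j)) ^ t * (ω ^ j) ^ t') := fun j => by
      simp only [star_mul', mul_pow, Complex.star_def, Complex.conj_ofReal]
      ring
    simp only [this]
    rw [← Finset.mul_sum, sum_primitiveRoot_pow hω (Finset.mem_range.1 ht) (Finset.mem_range.1 ht'),
      if_neg hne.symm]
    ring
  · exact fun h => absurd ht h

/-! ### The Cayley transform from the disc to the right half plane -/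

theorem one_add_ne_zero_of_norm_lt {w : ℂ} (hw : ‖w‖ < 1) : (1 + w) ≠ 0 := fun h => by
  have : w = -1 := by linear_combination h
  rw [this] at hw; simp at hw

theorem Complex.cayley_re_pos {w : ℂ} (hw : ‖w‖ < 1) : 0 < ((1 - w) / (1 + w)).re := by
  have h1 := one_add_ne_zero_of_norm_lt hw
  have hn : Complex.normSq w < 1 := by
    rw [Complex.normSq_eq_norm_sq]; nlinarith [norm_nonneg w]
  rw [Complex.normSq_apply] at hn
  have hp := Complex.normSq_pos.2 h1
  rw [Complex.div_re, ← add_div]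
  refine div_pos ?_ hp
  simp only [Complex.sub_re, Complex.add_re, Complex.one_re, Complex.sub_im, Complex.add_im,
    Complex.one_im]
  nlinarith

namespace RealizationArray
variable {n m : ℕ}

theorem det_cayley_ne_zero {A : Matrix (Fin n) (Fin n) ℂ}
    (hA : ∀ s : ℂ, 0 < s.re → (s • (1 : Matrix (Fin n) (Fin n) ℂ) - A).det ≠ 0) {w : ℂ}
    (hw : ‖w‖ < 1) : ((1 - w) • (1 : Matrix (Fin n) (Fin n) ℂ) - (1 + w) • A).det ≠ 0 := by
  have h1 := one_add_ne_zero_of_norm_lt hw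
  have e : (1 - w) • (1 : Matrix (Fin n) (Fin n) ℂ) - (1 + w) • A =
      (1 + w) • (((1 - w) / (1 + w)) • (1 : Matrix (Fin n) (Fin n) ℂ) - A) := by
    rw [smul_sub, smul_smul, mul_div_cancel₀ _ h1]
  rw [e, det_smul]
  exact mul_ne_zero (pow_ne_zero _ h1) (hA _ (Complex.cayley_re_pos hw))

/-- The free discrete-time evolution has its spectrum in the closed unit disc; take w = μ⁻¹ in
`det_cayley_ne_zero`. -/
theorem det_smul_one_sub_cayley_ne_zero {A : Matrix (Fin n) (Fin n) ℂ}
    (hA : ∀ s : ℂ, 0 < s.re → (s • (1 : Matrix (Fin n) (Fin n) ℂ) - A).det ≠ 0) {μ : ℂ}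
    (hμ : 1 < ‖μ‖) :
    (μ • (1 : Matrix (Fin n) (Fin n) ℂ) - (1 + A) * (1 - A)⁻¹).det ≠ 0 := by
  have hμ0 : μ ≠ 0 := by rintro rfl; simp at hμ; linarith
  have hu : IsUnit (1 - A).det := isUnit_iff_ne_zero.2 (by simpa using hA 1 (by simp))
  have hw : ‖μ⁻¹‖ < 1 := by rw [norm_inv]; exact inv_lt_one_of_one_lt₀ hμ
  have e : μ • (1 : Matrix (Fin n) (Fin n) ℂ) - (1 + A) * (1 - A)⁻¹ =
      μ • (((1 - μ⁻¹) • (1 : Matrix (Fin n) (Fin n) ℂ) - (1 + μ⁻¹) • A) * (1 - A)⁻¹) := by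
    rw [← Matrix.smul_mul, smul_sub, smul_smul, smul_smul]
    have e2 : (μ * (1 - μ⁻¹)) • (1 : Matrix (Fin n) (Fin n) ℂ) - (μ * (1 + μ⁻¹)) • A =
        μ • (1 - A) - (1 + A) := by
      rw [mul_sub, mul_add, mul_inv_cancel₀ hμ0]
      module
    rw [e2, Matrix.sub_mul, Matrix.smul_mul, Matrix.mul_nonsing_inv _ hu]
  rw [e, det_smul, det_mul]
  refine mul_ne_zero (pow_ne_zero _ hμ0) (mul_ne_zero (det_cayley_ne_zero hA hw) ?_)
  exact ((Matrix.isUnit_nonsing_inv_det_iff).2 hu).ne_zero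

/-- The adjugate form makes the continuous dependence of the solution on the entries of M evident.
-/
theorem mulVec_eq_iff_eq_inv_smul_adjugate {M : Matrix (Fin n) (Fin n) ℂ} (hM : M.det ≠ 0)
    (x y : Fin n → ℂ) : M *ᵥ x = y ↔ x = M.det⁻¹ • (M.adjugate *ᵥ y) := by
  constructor
  · rintro rfl
    rw [mulVec_mulVec, adjugate_mul, smul_mulVec, one_mulVec, smul_smul, inv_mul_cancel₀ hM,
      one_smul]
  · rintro rfl
    rw [mulVec_smul, mulVec_mulVec, mul_adjugate, smul_mulVec, one_mulVec, smul_smul,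
      inv_mul_cancel₀ hM, one_smul]

/-! ### Nonnegativity of the total supply -/

/-- With ξ t = x t - (A x t + B u t), the recursion makes the weighted sum telescope to ξ 0 - w^P ξ
P, and ξ 0 = 0. -/
theorem transform_identity {A : Matrix (Fin n) (Fin n) ℂ} {B : Matrix (Fin n) (Fin m) ℂ}
    {x : ℕ → Fin n → ℂ} {u : ℕ → Fin m → ℂ} (hx0 : x 0 = A *ᵥ x 0 + B *ᵥ u 0)
    (hx : ∀ t, x (t + 1) - (A *ᵥ x (t + 1) + B *ᵥ u (t + 1)) = x t + (A *ᵥ x t + B *ᵥ u t))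
    (w : ℂ) (P : ℕ) :
    ((1 - w) • (1 : Matrix (Fin n) (Fin n) ℂ) - (1 + w) • A) *ᵥ
        (∑ t ∈ Finset.range P, w ^ t • x t) =
      (1 + w) • B *ᵥ (∑ t ∈ Finset.range P, w ^ t • u t)
        - w ^ P • (x P - (A *ᵥ x P + B *ᵥ u P)) := by
  induction P with
  | zero => simp [← hx0]
  | succ P ih =>
    rw [Finset.sum_range_succ, Finset.sum_range_succ, mulVec_add, ih, mulVec_add, hx P, sub_mulVec,
      smul_mulVec, smul_mulVec, one_mulVec, mulVec_smul, mulVec_smul, pow_succ]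
    module

/-- The transform truncated at P solves the frequency-domain equation up to the error w^P ξ P. On
|w| = ρ this error tends to 0, so the supply of the transform is at least -ε on the circle for large
P; averaging over P-th roots of unity gives the weighted sum. -/
theorem sum_weighted_supply_nonneg {A : Matrix (Fin n) (Fin n) ℂ} {B : Matrix (Fin n) (Fin m) ℂ}
    {S : Matrix (Fin n ⊕ Fin m) (Fin n ⊕ Fin m) ℂ}
    (hA : ∀ s : ℂ, 0 < s.re → (s • (1 : Matrix (Fin n) (Fin n) ℂ) - A).det ≠ 0)
    (hS : ∀ s : ℂ, 0 < s.re → ∀ x u, s • x = A *ᵥ x + B *ᵥ u →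
      0 ≤ (star (Sum.elim x u) ⬝ᵥ S *ᵥ Sum.elim x u).re)
    (h0 : ∀ x, (star (Sum.elim x 0) ⬝ᵥ S *ᵥ Sum.elim x 0).re ≤ 0)
    {x : ℕ → Fin n → ℂ} {u : ℕ → Fin m → ℂ} (hx0 : x 0 = A *ᵥ x 0 + B *ᵥ u 0)
    (hx : ∀ t, x (t + 1) - (A *ᵥ x (t + 1) + B *ᵥ u (t + 1)) = x t + (A *ᵥ x t + B *ᵥ u t))
    {N : ℕ} (hu : ∀ t ≥ N, u t = 0) {ρ : ℝ} (hρ0 : 0 < ρ) (hρ1 : ρ < 1) :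
    0 ≤ ∑ t ∈ Finset.range N,
      (ρ ^ 2) ^ t * (star (Sum.elim (x t) (u t)) ⬝ᵥ S *ᵥ Sum.elim (x t) (u t)).re := by
  set ξ : ℕ → Fin n → ℂ := fun t => x t - (A *ᵥ x t + B *ᵥ u t) with hξ
  let uh : ℂ → Fin m → ℂ := fun w => ∑ t ∈ Finset.range N, w ^ t • u t
  let K : ℂ → Matrix (Fin n) (Fin n) ℂ := fun w => (1 - w) • 1 - (1 + w) • A
  -- Solution of the transformed state equation at w, with a perturbation η as first argument: η = 0
  -- is the exact equation, η = w^P ξ P the truncated one.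
  let Y : (Fin n → ℂ) × ℂ → Fin n → ℂ := fun p =>
    (K p.2).det⁻¹ • ((K p.2).adjugate *ᵥ ((1 + p.2) • B *ᵥ uh p.2 - p.1))
  let V : (Fin n → ℂ) × ℂ → Fin n ⊕ Fin m → ℂ := fun p => Sum.elim (Y p) (uh p.2)
  have hu1 : IsUnit (1 - A).det := isUnit_iff_ne_zero.2 (by simpa using hA 1 (by simp))
  -- the tail of the state sequence decays
  have hstep : ∀ t ≥ N, ξ (t + 1) = ((1 + A) * (1 - A)⁻¹) *ᵥ ξ t := fun t ht => by
    have e1 : ξ t = (1 - A) *ᵥ x t := by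
      simp [hξ, hu t ht, sub_mulVec]
    rw [e1, mulVec_mulVec, Matrix.mul_assoc, Matrix.nonsing_inv_mul _ hu1, Matrix.mul_one]
    simp only [hξ]
    rw [hx t, hu t ht]
    simp [add_mulVec]
  have htail : ∀ j, ξ (j + N) = (((1 + A) * (1 - A)⁻¹) ^ j) *ᵥ ξ N := fun j => by
    induction j with
    | zero => simp
    | succ j ih =>
      rw [show j + 1 + N = (j + N) + 1 by ring, hstep _ (by omega), ih, mulVec_mulVec, pow_succ']
  have hlim : Tendsto (fun k => ρ ^ k * ‖ξ k‖) atTop (𝓝 0) := by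
    rw [← tendsto_add_atTop_iff_nat N]
    have h := (Matrix.tendsto_smul_pow_mulVec
      (fun μ hμ => det_smul_one_sub_cayley_ne_zero hA hμ) hρ0 hρ1 (ξ N)).const_mul (ρ ^ N)
    rw [mul_zero] at h
    refine h.congr fun k => ?_
    rw [htail, pow_add]; ring
  -- near the circle of radius `ρ` the transformed supply is almost nonnegative
  have hsphere : ∀ w ∈ Metric.sphere (0 : ℂ) ρ, ‖w‖ < 1 := fun w hw => by
    rw [mem_sphere_zero_iff_norm] at hw; rw [hw]; exact hρ1
  have hcont : ∀ w ∈ Metric.sphere (0 : ℂ) ρ,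
      ContinuousAt (fun p => (star (V p) ⬝ᵥ S *ᵥ V p).re) ((0 : Fin n → ℂ), w) := fun w hw => by
    have hY : ContinuousAt Y ((0 : Fin n → ℂ), w) := by
      have hd : ContinuousAt (fun p : (Fin n → ℂ) × ℂ => (K p.2).det) (0, w) :=
        (by fun_prop : Continuous fun p : (Fin n → ℂ) × ℂ => (K p.2).det).continuousAt
      have ha : ContinuousAt (fun p : (Fin n → ℂ) × ℂ =>
          (K p.2).adjugate *ᵥ ((1 + p.2) • B *ᵥ uh p.2 - p.1)) (0, w) :=
        (by fun_prop : Continuous fun p : (Fin n → ℂ) × ℂ =>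
          (K p.2).adjugate *ᵥ ((1 + p.2) • B *ᵥ uh p.2 - p.1)).continuousAt
      exact (hd.inv₀ (det_cayley_ne_zero hA (hsphere w hw))).smul ha
    have hV : ContinuousAt V ((0 : Fin n → ℂ), w) := by
      refine continuousAt_pi.2 fun i => ?_
      rcases i with i | i
      · exact (continuousAt_pi.1 hY) i
      · exact (by fun_prop : Continuous fun p : (Fin n → ℂ) × ℂ => uh p.2 i).continuousAt
    have hq : Continuous fun v : Fin n ⊕ Fin m → ℂ => (star v ⬝ᵥ S *ᵥ v).re := by fun_prop
    exact hq.continuousAt.comp hV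
  have hval : ∀ w ∈ Metric.sphere (0 : ℂ) ρ, 0 ≤ (star (V (0, w)) ⬝ᵥ S *ᵥ V (0, w)).re :=
    fun w hw => by
    have h1 := one_add_ne_zero_of_norm_lt (hsphere w hw)
    refine hS _ (Complex.cayley_re_pos (hsphere w hw)) _ _ ?_
    have h2 := (mulVec_eq_iff_eq_inv_smul_adjugate (det_cayley_ne_zero hA (hsphere w hw))
      (Y (0, w)) ((1 + w) • B *ᵥ uh w - 0)).2 rfl
    rw [sub_zero, sub_mulVec, smul_mulVec, smul_mulVec, one_mulVec, sub_eq_iff_eq_add] at h2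
    rw [div_eq_inv_mul, mul_smul, h2, ← smul_add, smul_smul, inv_mul_cancel₀ h1, one_smul, add_comm]
  refine le_of_forall_pos_lt_add fun ε hε => ?_
  -- Compactness of the circle makes the bound uniform in w.
  have hev : ∀ᶠ η in 𝓝 (0 : Fin n → ℂ), ∀ w ∈ Metric.sphere (0 : ℂ) ρ,
      -ε < (star (V (η, w)) ⬝ᵥ S *ᵥ V (η, w)).re :=
    (isCompact_sphere 0 ρ).eventually_forall_of_forall_eventually fun w hw =>
      (hcont w hw).eventually_const_lt (by have := hval w hw; linarith)
  obtain ⟨δ, hδ, hball⟩ := Metric.eventually_nhds_iff.1 hev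
  obtain ⟨P, hPδ, hPN⟩ := ((hlim.eventually_lt_const hδ).and (eventually_gt_atTop N)).exists
  have hP0 : P ≠ 0 := by omega
  have hω := Complex.isPrimitiveRoot_exp P hP0
  set ω := Complex.exp (2 * Real.pi * Complex.I / P)
  have hV : ∀ w ∈ Metric.sphere (0 : ℂ) ρ, V (w ^ P • ξ P, w) =
      ∑ t ∈ Finset.range P, w ^ t • Sum.elim (x t) (u t) := fun w hw => by
    have h1 := (mulVec_eq_iff_eq_inv_smul_adjugate (det_cayley_ne_zero hA (hsphere w hw)) _ _).1
      (transform_identity hx0 hx w P)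
    have h2 : ∑ t ∈ Finset.range P, w ^ t • u t = uh w := by
      refine (Finset.sum_subset (Finset.range_subset_range.2 hPN.le) fun t _ ht => ?_).symm
      rw [hu t (by simpa using ht), smul_zero]
    rw [h2] at h1
    ext i
    rcases i with i | i
    · have := congrFun h1.symm i
      simpa [Finset.sum_apply, V, Y, K] using this
    · have := congrFun h2.symm i
      simpa [Finset.sum_apply, V] using this
  have hmem : ∀ j, (ρ * ω ^ j : ℂ) ∈ Metric.sphere (0 : ℂ) ρ := fun j => by
    rw [mem_sphere_zero_iff_norm, norm_mul, norm_pow, hω.norm'_eq_one hP0]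
    simp [abs_of_pos hρ0]
  have hlow : ∀ j, -ε < (star (∑ t ∈ Finset.range P, (ρ * ω ^ j : ℂ) ^ t • Sum.elim (x t) (u t)) ⬝ᵥ
      S *ᵥ (∑ t ∈ Finset.range P, (ρ * ω ^ j : ℂ) ^ t • Sum.elim (x t) (u t))).re := fun j => by
    rw [← hV _ (hmem j)]
    refine hball ?_ _ (hmem j)
    rw [dist_zero_right, norm_smul, norm_pow, mem_sphere_zero_iff_norm.1 (hmem j)]
    exact hPδ
  have hsum := congrArg Complex.re (sum_roots_form S (fun t => Sum.elim (x t) (u t)) hω ρ)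
  rw [Complex.re_sum, ← Complex.ofReal_natCast, Complex.re_ofReal_mul, Complex.re_sum] at hsum
  simp only [Complex.re_ofReal_mul] at hsum
  have hsum2 : (P : ℝ) * -ε < P * ∑ t ∈ Finset.range P,
      (ρ ^ 2) ^ t * (star (Sum.elim (x t) (u t)) ⬝ᵥ S *ᵥ Sum.elim (x t) (u t)).re := by
    rw [← hsum]
    calc (P : ℝ) * -ε = ∑ j ∈ Finset.range P, -ε := by simp
      _ < _ := Finset.sum_lt_sum_of_nonempty (by simpa using hP0) fun j _ => hlow j
  have hsum3 := lt_of_mul_lt_mul_left hsum2 (Nat.cast_nonneg P)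
  -- For N ≤ t < P the input vanishes, so by `h0` these terms only lower the sum.
  have hle : ∑ t ∈ Finset.range P,
      (ρ ^ 2) ^ t * (star (Sum.elim (x t) (u t)) ⬝ᵥ S *ᵥ Sum.elim (x t) (u t)).re ≤
      ∑ t ∈ Finset.range N,
      (ρ ^ 2) ^ t * (star (Sum.elim (x t) (u t)) ⬝ᵥ S *ᵥ Sum.elim (x t) (u t)).re := by
    rw [← Finset.sum_range_add_sum_Ico _ hPN.le]
    refine add_le_of_nonpos_right (Finset.sum_nonpos fun t ht => ?_)
    rw [hu t (Finset.mem_Ico.1 ht).1]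
    exact mul_nonpos_of_nonneg_of_nonpos (by positivity) (h0 _)
  linarith

/-- The total supply along a trajectory that starts at rest is nonnegative. -/
theorem sum_supply_nonneg {A : Matrix (Fin n) (Fin n) ℂ} {B : Matrix (Fin n) (Fin m) ℂ}
    {S : Matrix (Fin n ⊕ Fin m) (Fin n ⊕ Fin m) ℂ}
    (hA : ∀ s : ℂ, 0 < s.re → (s • (1 : Matrix (Fin n) (Fin n) ℂ) - A).det ≠ 0)
    (hS : ∀ s : ℂ, 0 < s.re → ∀ x u, s • x = A *ᵥ x + B *ᵥ u →
      0 ≤ (star (Sum.elim x u) ⬝ᵥ S *ᵥ Sum.elim x u).re)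
    (h0 : ∀ x, (star (Sum.elim x 0) ⬝ᵥ S *ᵥ Sum.elim x 0).re ≤ 0)
    {x : ℕ → Fin n → ℂ} {u : ℕ → Fin m → ℂ} (hx0 : x 0 = A *ᵥ x 0 + B *ᵥ u 0)
    (hx : ∀ t, x (t + 1) - (A *ᵥ x (t + 1) + B *ᵥ u (t + 1)) = x t + (A *ᵥ x t + B *ᵥ u t))
    {N : ℕ} (hu : ∀ t ≥ N, u t = 0) :
    0 ≤ ∑ t ∈ Finset.range N, (star (Sum.elim (x t) (u t)) ⬝ᵥ S *ᵥ Sum.elim (x t) (u t)).re := by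
  have hc : Continuous fun ρ : ℝ => ∑ t ∈ Finset.range N,
      (ρ ^ 2) ^ t * (star (Sum.elim (x t) (u t)) ⬝ᵥ S *ᵥ Sum.elim (x t) (u t)).re := by fun_prop
  have hl : Tendsto (fun ρ : ℝ => ∑ t ∈ Finset.range N,
      (ρ ^ 2) ^ t * (star (Sum.elim (x t) (u t)) ⬝ᵥ S *ᵥ Sum.elim (x t) (u t)).re) (𝓝[<] 1)
      (𝓝 (∑ t ∈ Finset.range N,
        (star (Sum.elim (x t) (u t)) ⬝ᵥ S *ᵥ Sum.elim (x t) (u t)).re)) := by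
    have := hc.tendsto 1
    simp only [one_pow, one_mul] at this
    exact this.mono_left nhdsWithin_le_nhds
  refine ge_of_tendsto hl ?_
  filter_upwards [Ioo_mem_nhdsLT (show (0 : ℝ) < 1 by norm_num)] with ρ hρ
  exact sum_weighted_supply_nonneg hA hS h0 hx0 hx hu hρ.1 hρ.2

end RealizationArray

/-! ### The storage function as an infimum over trajectories -/

theorem exists_quotient_form_of_core {n : ℕ} {E : Type*} [AddCommGroup E] [Module ℂ E]
    (c : PreInnerProductSpace.Core ℂ E) (Φ : E →ₗ[ℂ] (Fin n → ℂ)) (hΦ : Function.Surjective Φ) :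
    ∃ H : Matrix (Fin n) (Fin n) ℂ, H.PosSemidef ∧
      (∀ f, (star (Φ f) ⬝ᵥ H *ᵥ Φ f).re ≤ (c.inner f f).re) ∧
      ∀ x, ∀ ε > 0, ∃ f, Φ f = x ∧ (c.inner f f).re < (star x ⬝ᵥ H *ᵥ x).re + ε := by
  let _ : SeminormedAddCommGroup E := InnerProductSpace.Core.toSeminormedAddCommGroup (𝕜 := ℂ)
  let _ : InnerProductSpace ℂ E := InnerProductSpace.ofCore c
  have h : ∀ f : E, ‖f‖ ^ 2 = (c.inner f f).re := fun f => norm_sq_eq_re_inner (𝕜 := ℂ) f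
  simp only [← h]
  exact exists_quotient_form Φ hΦ

section Trajectory

variable {n : ℕ} {ι : Type*}

/-- Finitely supported sequences `p`, indexed by reversed time, with `fm (p k) = fp (p (k + 1))`. -/
def trajectories (fm fp : (ι → ℂ) →ₗ[ℂ] (Fin n → ℂ)) : Submodule ℂ (ℕ →₀ (ι → ℂ)) where
  carrier := {p | ∀ k, fm (p k) = fp (p (k + 1))}
  add_mem' := fun {p q} hp hq k => by
    simp only [Finsupp.add_apply, map_add]; rw [hp k, hq k]
  zero_mem' := fun k => by simp
  smul_mem' := fun a p hp k => by
    simp only [Finsupp.smul_apply, map_smul]; rw [hp k]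

/-- The trajectory `p` continued by `v`. -/
noncomputable def consTrajectory (v : ι → ℂ) (p : ℕ →₀ (ι → ℂ)) : ℕ →₀ (ι → ℂ) :=
  Finsupp.onFinset (Finset.range (p.support.sup id + 2)) (fun k => Nat.casesOn k v p) (by
    intro k hk
    rcases k with _ | k
    · simp
    · have : k ∈ p.support := Finsupp.mem_support_iff.2 hk
      have := Finset.subset_range_sup_succ p.support this
      simp only [Finset.mem_range] at this ⊢
      omega)

@[simp] theorem consTrajectory_zero (v : ι → ℂ) (p : ℕ →₀ (ι → ℂ)) :
    consTrajectory v p 0 = v := rfl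

@[simp] theorem consTrajectory_succ (v : ι → ℂ) (p : ℕ →₀ (ι → ℂ)) (k : ℕ) :
    consTrajectory v p (k + 1) = p k := rfl

variable [Fintype ι]

theorem sum_form_eq_range (S : Matrix ι ι ℂ) (p q : ℕ →₀ (ι → ℂ)) {N : ℕ}
    (hN : p.support ⊆ Finset.range N) :
    (p.sum fun k v => star v ⬝ᵥ S *ᵥ q k) =
      ∑ k ∈ Finset.range N, star (p k) ⬝ᵥ S *ᵥ q k :=
  Finsupp.sum_of_support_subset _ hN _ (by simp)

theorem exists_support_subset_range {M : Type*} [Zero M] (p q : ℕ →₀ M) :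
    ∃ N, p.support ⊆ Finset.range N ∧ q.support ⊆ Finset.range N := by
  classical
  refine ⟨(p.support ∪ q.support).sup id + 1, ?_, ?_⟩
  · exact Finset.subset_union_left.trans (Finset.subset_range_sup_succ _)
  · exact Finset.subset_union_right.trans (Finset.subset_range_sup_succ _)

/-- The total supply along trajectories, as a semidefinite inner product. -/
noncomputable abbrev supplyCore {S : Matrix ι ι ℂ} (hS : S.IsHermitian)
    (E : Submodule ℂ (ℕ →₀ (ι → ℂ)))
    (hE : ∀ p ∈ E, 0 ≤ (p.sum fun k v => star v ⬝ᵥ S *ᵥ p k).re) :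
    PreInnerProductSpace.Core ℂ E where
  inner p q := p.1.sum fun k v => star v ⬝ᵥ S *ᵥ q.1 k
  conj_inner_symm p q := by
    obtain ⟨N, hp, hq⟩ := exists_support_subset_range p.1 q.1
    rw [sum_form_eq_range S _ _ hp, sum_form_eq_range S _ _ hq, map_sum]
    exact Finset.sum_congr rfl fun k _ => star_star_dotProduct_mulVec hS _ _
  re_inner_nonneg p := hE p.1 p.2
  add_left p q r := by
    refine Finsupp.sum_add_index' (by simp) fun k v w => ?_
    rw [star_add, add_dotProduct]
  smul_left p q a := by
    refine (Finsupp.sum_smul_index' (by simp)).trans ?_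
    rw [Finsupp.sum, Finsupp.sum, Finset.mul_sum]
    refine Finset.sum_congr rfl fun k _ => ?_
    rw [star_smul, smul_dotProduct]
    rfl

theorem sum_form_consTrajectory (S : Matrix ι ι ℂ) (v : ι → ℂ) (p : ℕ →₀ (ι → ℂ)) :
    ((consTrajectory v p).sum fun k w => star w ⬝ᵥ S *ᵥ consTrajectory v p k) =
      (p.sum fun k w => star w ⬝ᵥ S *ᵥ p k) + star v ⬝ᵥ S *ᵥ v := by
  rw [sum_form_eq_range S (consTrajectory v p) _ (N := p.support.sup id + 2)
      Finsupp.support_onFinset_subset,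
    sum_form_eq_range S p p (Finset.subset_range_sup_succ _), Finset.sum_range_succ']
  simp

/-- H measures the least supply needed to reach a state from rest. Appending v to a nearly optimal
trajectory ending at fm v gives one ending at fp v, at extra cost v*Sv. -/
theorem exists_storage {S : Matrix ι ι ℂ} (hS : S.IsHermitian)
    (fm fp : (ι → ℂ) →ₗ[ℂ] (Fin n → ℂ))
    (hE : ∀ p ∈ trajectories fm fp, 0 ≤ (p.sum fun k v => star v ⬝ᵥ S *ᵥ p k).re)
    (hreach : ∀ W : Submodule ℂ (Fin n → ℂ), (∀ v, fm v ∈ W → fp v ∈ W) → W = ⊤) :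
    ∃ H : Matrix (Fin n) (Fin n) ℂ, H.PosSemidef ∧ ∀ v,
      (star (fp v) ⬝ᵥ H *ᵥ fp v).re ≤
        (star (fm v) ⬝ᵥ H *ᵥ fm v).re + (star v ⬝ᵥ S *ᵥ v).re := by
  let E := trajectories fm fp
  let Φ : E →ₗ[ℂ] (Fin n → ℂ) := fp ∘ₗ Finsupp.lapply 0 ∘ₗ E.subtype
  have hΦ : ∀ p : E, Φ p = fp (p.1 0) := fun p => rfl
  have hcons : ∀ (p : E) v, fm v = Φ p → consTrajectory v p.1 ∈ E := fun p v hv k => by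
    rcases k with _ | k
    · exact hv
    · exact p.2 k
  have hsurj : Function.Surjective Φ := by
    rw [← LinearMap.range_eq_top]
    refine hreach _ fun v hv => ?_
    obtain ⟨p, hp⟩ := hv
    exact ⟨⟨_, hcons p v hp.symm⟩, rfl⟩
  obtain ⟨H, hH, hle, happ⟩ := exists_quotient_form_of_core (supplyCore hS E hE) Φ hsurj
  refine ⟨H, hH, fun v => le_of_forall_pos_le_add fun ε hε => ?_⟩
  obtain ⟨p, hp, hpε⟩ := happ (fm v) ε hε
  have h1 := hle ⟨_, hcons p v hp.symm⟩
  have h2 : ((supplyCore hS E hE).inner ⟨_, hcons p v hp.symm⟩ ⟨_, hcons p v hp.symm⟩) =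
    (supplyCore hS E hE).inner p p + star v ⬝ᵥ S *ᵥ v := sum_form_consTrajectory S v p.1
  rw [h2, Complex.add_re] at h1
  have h3 : (star (fp v) ⬝ᵥ H *ᵥ fp v).re ≤ _ := h1
  linarith

end Trajectory

/-! ### Eigenvalues of A are poles of the transfer function -/

namespace RealizationArray
variable {n m : ℕ}

/-- The vectors b for which C (s - A)⁻¹ b stays bounded near s₀ form an A-invariant subspace
containing the range of B, hence everything. For an eigenvector x at s₀ this function is Cx / (s -
s₀), so Cx = 0, against observability. -/
theorem IsControllable.det_ne_zero_of_analyticAtPoint {A : Matrix (Fin n) (Fin n) ℂ}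
    {B : Matrix (Fin n) (Fin m) ℂ} {C : Matrix (Fin m) (Fin n) ℂ} {D : Matrix (Fin m) (Fin m) ℂ}
    (hc : IsControllable A B) (ho : IsObservable C A) {s₀ : ℂ}
    (h : (transferFunction (fromBlocks A B C D)).AnalyticAtPoint s₀) :
    (s₀ • (1 : Matrix (Fin n) (Fin n) ℂ) - A).det ≠ 0 := by
  intro hdet
  have hev : ∀ᶠ s in 𝓝[≠] s₀, A.charpoly.eval s ≠ 0 := by
    have hfin : {s | A.charpoly.IsRoot s}.Finite :=
      Polynomial.finite_setOfPred_isRoot (charpoly_monic A).ne_zero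
    exact nhdsNE_le_cofinite s₀ hfin.eventually_cofinite_notMem
  have hinv : ∀ {s}, A.charpoly.eval s ≠ 0 → IsUnit (s • (1 : Matrix (Fin n) (Fin n) ℂ) - A).det :=
    fun hs => isUnit_iff_ne_zero.2 (by rwa [eval_charpoly] at hs)
  let W : Submodule ℂ (Fin n → ℂ) :=
    { carrier := {b | (fun s : ℂ => C *ᵥ ((s • 1 - A)⁻¹ *ᵥ b)) =O[𝓝[≠] s₀] fun _ => (1 : ℂ)}
      add_mem' := fun {a b} ha hb => by
        simp only [Set.mem_ofPred_eq, mulVec_add] at *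
        exact ha.add hb
      zero_mem' := by
        simp only [Set.mem_ofPred_eq, mulVec_zero]
        exact isBigO_zero _ _
      smul_mem' := fun a b hb => by
        simp only [Set.mem_ofPred_eq, mulVec_smul] at *
        exact hb.const_smul_left a }
  have hW : W = ⊤ := by
    refine hc W (fun b hb => ?_) fun u => ?_
    -- Invariance comes from C (s - A)⁻¹ A b = s C (s - A)⁻¹ b - C b.
    · have h1 : (fun s : ℂ => s • (C *ᵥ ((s • 1 - A)⁻¹ *ᵥ b)) - C *ᵥ b) =O[𝓝[≠] s₀]
          fun _ => (1 : ℂ) := by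
        refine IsBigO.sub ?_ (isBigO_const_const _ one_ne_zero _)
        have h2 : (fun s : ℂ => s) =O[𝓝[≠] s₀] fun _ => (1 : ℂ) :=
          (tendsto_id.mono_left nhdsWithin_le_nhds).isBigO_one ℂ
        simpa using h2.smul hb
      refine h1.congr' ?_ EventuallyEq.rfl
      filter_upwards [hev] with s hs
      have h3 : A *ᵥ b = s • b - (s • (1 : Matrix (Fin n) (Fin n) ℂ) - A) *ᵥ b := by
        rw [sub_mulVec, smul_mulVec, one_mulVec, sub_sub_cancel]
      rw [h3, mulVec_sub, mulVec_mulVec _ _ (s • 1 - A), nonsing_inv_mul _ (hinv hs), one_mulVec,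
        mulVec_smul, mulVec_sub, mulVec_smul]
    · have h1 : Tendsto (fun s => (transferFunction (fromBlocks A B C D)).value s *ᵥ u - D *ᵥ u)
          (𝓝[≠] s₀) (𝓝 ((transferFunction (fromBlocks A B C D)).value s₀ *ᵥ u - D *ᵥ u)) := by
        have hv : ContinuousAt (fun s => (transferFunction (fromBlocks A B C D)).value s) s₀ :=
          continuousAt_pi.2 fun i => continuousAt_pi.2 fun j => (h i j).continuousAt
        have hm : Continuous fun M : Matrix (Fin m) (Fin m) ℂ => M *ᵥ u - D *ᵥ u := by fun_prop
        exact (hm.continuousAt.comp hv).mono_left nhdsWithin_le_nhds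
      refine (h1.isBigO_one ℂ).congr' ?_ EventuallyEq.rfl
      filter_upwards [hev] with s hs
      rw [value_transferFunction _ (by simpa using hs)]
      simp [add_mulVec, mulVec_mulVec, Matrix.mul_assoc]
  obtain ⟨x, hx0, hx⟩ := exists_mulVec_eq_zero_iff.2 hdet
  rw [sub_mulVec, smul_mulVec, one_mulVec, sub_eq_zero] at hx
  have hxW : x ∈ W := hW ▸ Submodule.mem_top
  have hCx : C *ᵥ x = 0 := by
    have h1 : (fun s : ℂ => (s - s₀) • (C *ᵥ ((s • 1 - A)⁻¹ *ᵥ x))) =O[𝓝[≠] s₀]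
        fun s => (s - s₀) • (1 : ℂ) := (isBigO_refl _ _).smul hxW
    have h2 : (fun _ : ℂ => C *ᵥ x) =O[𝓝[≠] s₀] fun s => (s - s₀) • (1 : ℂ) := by
      refine h1.congr' ?_ EventuallyEq.rfl
      filter_upwards [hev] with s hs
      have h3 : (s • (1 : Matrix (Fin n) (Fin n) ℂ) - A) *ᵥ x = (s - s₀) • x := by
        rw [sub_mulVec, smul_mulVec, one_mulVec, ← hx, sub_smul]
      rw [← mulVec_smul, ← mulVec_smul, ← h3, mulVec_mulVec _ _ (s • 1 - A),
        nonsing_inv_mul _ (hinv hs), one_mulVec]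
    have h4 : Tendsto (fun s : ℂ => (s - s₀) • (1 : ℂ)) (𝓝[≠] s₀) (𝓝 0) := by
      have : Continuous fun s : ℂ => (s - s₀) • (1 : ℂ) := by fun_prop
      simpa using (this.tendsto s₀).mono_left nhdsWithin_le_nhds
    exact tendsto_nhds_unique tendsto_const_nhds (h2.trans_tendsto h4)
  have hspan := ho (ℂ ∙ x) (fun y hy => by
      obtain ⟨a, rfl⟩ := Submodule.mem_span_singleton.1 hy
      rw [mulVec_smul, ← hx]
      exact Submodule.smul_mem _ _ (Submodule.smul_mem _ _ (Submodule.mem_span_singleton_self x)))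
    (fun y hy => by
      obtain ⟨a, rfl⟩ := Submodule.mem_span_singleton.1 hy
      rw [mulVec_smul, hCx, smul_zero])
  exact hx0 (Submodule.span_singleton_eq_bot.1 hspan)

/-! ### Sufficiency of the inequality and definiteness of H -/

theorem re_form_smul {ι : Type*} [Fintype ι] {H : Matrix ι ι ℂ} (hH : H.IsHermitian)
    (x : ι → ℂ) (s : ℂ) :
    (star x ⬝ᵥ H *ᵥ (s • x)).re = s.re * (star x ⬝ᵥ H *ᵥ x).re := by
  have him : (star x ⬝ᵥ H *ᵥ x).im = 0 := by
    have := congrArg Complex.im (star_star_dotProduct_mulVec hH x x)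
    simp only [Complex.star_def, Complex.conj_im] at this
    linarith
  rw [mulVec_smul, dotProduct_smul, smul_eq_mul, Complex.mul_re, him]
  ring

theorem posDef_re_pos {ι : Type*} [Fintype ι] {H : Matrix ι ι ℂ} (hH : H.PosDef) {x : ι → ℂ}
    (hx : x ≠ 0) : 0 < (star x ⬝ᵥ H *ᵥ x).re :=
  (Complex.lt_def.1 (hH.dotProduct_mulVec_pos hx)).1

theorem value_mulVec (R : RealizationArray n m) {s : ℂ}
    (hs : (s • (1 : Matrix (Fin n) (Fin n) ℂ) - toBlocks₁₁ R).det ≠ 0) (x : Fin n → ℂ)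
    (u : Fin m → ℂ) (hx : s • x = toBlocks₁₁ R *ᵥ x + toBlocks₁₂ R *ᵥ u) :
    (transferFunction R).value s *ᵥ u = (R *ᵥ Sum.elim x u) ∘ Sum.inr := by
  have h1 : (s • (1 : Matrix (Fin n) (Fin n) ℂ) - toBlocks₁₁ R) *ᵥ x = toBlocks₁₂ R *ᵥ u := by
    rw [sub_mulVec, smul_mulVec, one_mulVec, hx, add_sub_cancel_left]
  rw [value_transferFunction _ (by rwa [eval_charpoly]), mulVec_eq_elim, add_mulVec,
    ← mulVec_mulVec, ← mulVec_mulVec, ← h1, mulVec_mulVec _ _ (s • 1 - _),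
    nonsing_inv_mul _ (isUnit_iff_ne_zero.2 hs), one_mulVec]
  simp

/-- An eigenvector x with zero input would give 2 Re(s) x*Hx + y*Ty ≤ 0. -/
theorem QuadraticInequality.det_ne_zero {T : Matrix (Fin m) (Fin m) ℂ}
    {H : Matrix (Fin n) (Fin n) ℂ} (hT : T.PosSemidef) (hH : H.PosDef) {R : RealizationArray n m}
    (hQ : QuadraticInequality T H R) {s : ℂ} (hs : 0 < s.re) :
    (s • (1 : Matrix (Fin n) (Fin n) ℂ) - toBlocks₁₁ R).det ≠ 0 := by
  intro hdet
  obtain ⟨x, hx0, hx⟩ := exists_mulVec_eq_zero_iff.2 hdet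
  rw [sub_mulVec, smul_mulVec, one_mulVec, sub_eq_zero] at hx
  have h1 := (quadraticInequality_iff hT.isHermitian hH.isHermitian R).1 hQ (Sum.elim x 0)
  have h2 : (R *ᵥ Sum.elim x 0) ∘ Sum.inl = s • x := by
    rw [mulVec_eq_elim]; simp [hx]
  rw [h2, Sum.elim_comp_inl, Sum.elim_comp_inr, re_form_smul hH.isHermitian] at h1
  have h3 := (posSemidef_iff_re hT.isHermitian).1 hT ((R *ᵥ Sum.elim x 0) ∘ Sum.inr)
  have h4 := mul_pos hs (posDef_re_pos hH hx0)
  simp only [star_zero, zero_dotProduct, Complex.zero_re] at h1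
  linarith

theorem QuadraticInequality.isHyperPositive {T : Matrix (Fin m) (Fin m) ℂ}
    {H : Matrix (Fin n) (Fin n) ℂ} (hT : T.PosSemidef) (hH : H.PosDef) {R : RealizationArray n m}
    (hQ : QuadraticInequality T H R) : (transferFunction R).IsHyperPositive T := by
  intro s hs
  have hdet := hQ.det_ne_zero hT hH hs
  refine ⟨analyticAtPoint_transferFunction R (by rwa [eval_charpoly]),
    (hyperPositive_posSemidef_iff hT.isHermitian _).2 fun u => ?_⟩
  let x := (s • (1 : Matrix (Fin n) (Fin n) ℂ) - toBlocks₁₁ R)⁻¹ *ᵥ (toBlocks₁₂ R *ᵥ u)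
  have hx : s • x = toBlocks₁₁ R *ᵥ x + toBlocks₁₂ R *ᵥ u := by
    have : (s • (1 : Matrix (Fin n) (Fin n) ℂ) - toBlocks₁₁ R) *ᵥ x = toBlocks₁₂ R *ᵥ u := by
      rw [mulVec_mulVec, mul_nonsing_inv _ (isUnit_iff_ne_zero.2 hdet), one_mulVec]
    rw [sub_mulVec, smul_mulVec, one_mulVec] at this
    rw [← this, add_sub_cancel]
  have h1 := (quadraticInequality_iff hT.isHermitian hH.isHermitian R).1 hQ (Sum.elim x u)
  have h2 : (R *ᵥ Sum.elim x u) ∘ Sum.inl = s • x := by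
    rw [mulVec_eq_elim, hx]; simp
  rw [h2, ← value_mulVec R hdet x u hx, Sum.elim_comp_inl, Sum.elim_comp_inr,
    re_form_smul hH.isHermitian] at h1
  have h3 := (posSemidef_iff_re hH.isHermitian).1 hH.posSemidef x
  have h4 := mul_nonneg hs.le h3
  linarith

theorem nonpos_of_forall_pos_mul_add_sq {a b : ℝ} (h : ∀ ε : ℝ, 0 < ε → ε * a + ε ^ 2 * b ≤ 0) :
    a ≤ 0 := by
  have h1 : Tendsto (fun ε : ℝ => a + ε * b) (𝓝[>] 0) (𝓝 a) := by
    have : Continuous fun ε : ℝ => a + ε * b := by fun_prop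
    simpa using (this.tendsto 0).mono_left nhdsWithin_le_nhds
  refine le_of_tendsto h1 ?_
  filter_upwards [self_mem_nhdsWithin] with ε hε
  have h2 := h ε hε
  have h3 : ε * (a + ε * b) ≤ 0 := by linarith [h2]
  exact nonpos_of_mul_nonpos_right h3 hε

theorem eq_zero_of_re_star_dotProduct_self_nonpos {ι : Type*} [Fintype ι] {x : ι → ℂ}
    (h : (star x ⬝ᵥ x).re ≤ 0) : x = 0 := by
  by_contra hx
  exact absurd (Complex.lt_def.1 (dotProduct_star_self_pos_iff.2 hx)).1
    (by simpa using h)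

/-- The kernel of H is A-invariant and lies in the kernel of C. Both follow by perturbing a kernel
vector and comparing first-order terms. -/
theorem IsObservable.posDef {A : Matrix (Fin n) (Fin n) ℂ} {B : Matrix (Fin n) (Fin m) ℂ}
    {C : Matrix (Fin m) (Fin n) ℂ} {D : Matrix (Fin m) (Fin m) ℂ} (ho : IsObservable C A)
    {T : Matrix (Fin m) (Fin m) ℂ} {H : Matrix (Fin n) (Fin n) ℂ} (hT : T.PosSemidef)
    (hH : H.PosSemidef) (hQ : QuadraticInequality T H (fromBlocks A B C D)) : H.PosDef := by
  rw [quadraticInequality_iff hT.isHermitian hH.isHermitian] at hQ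
  have hTn := (posSemidef_iff_re hT.isHermitian).1 hT
  have hker : ∀ x, H *ᵥ x = 0 → ∀ z, star x ⬝ᵥ H *ᵥ z = 0 := fun x hx z => by
    rw [← star_star_dotProduct_mulVec hH.isHermitian, hx]; simp
  have hQ' : ∀ x u, 2 * (star x ⬝ᵥ H *ᵥ (A *ᵥ x + B *ᵥ u)).re ≤
      2 * (star u ⬝ᵥ (C *ᵥ x + D *ᵥ u)).re := fun x u => by
    have h1 := hQ (Sum.elim x u)
    rw [fromBlocks_mulVec] at h1
    simp only [Sum.elim_comp_inl, Sum.elim_comp_inr] at h1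
    linarith [hTn (C *ᵥ x + D *ᵥ u), hTn u]
  have hW := ho (LinearMap.ker (toLin' H)) (fun x hx => by
      rw [LinearMap.mem_ker, toLin'_apply] at hx ⊢
      refine eq_zero_of_re_star_dotProduct_self_nonpos ?_
      -- Testing with state x + εz and zero input yields ε‖z‖² + O(ε²) ≤ 0.
      set z := H *ᵥ (A *ᵥ x) with hz
      refine nonpos_of_forall_pos_mul_add_sq (b := (star z ⬝ᵥ H *ᵥ (A *ᵥ z)).re) fun ε hε => ?_
      have h2 : star x ⬝ᵥ z = 0 := hker x hx _
      have h1 := hQ' (x + (ε : ℂ) • z) 0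
      simp only [mulVec_zero, add_zero, star_zero, zero_dotProduct, Complex.zero_re, mulVec_add,
        mulVec_smul, star_add, add_dotProduct, dotProduct_add, hker x hx, star_smul,
        smul_dotProduct, dotProduct_smul, smul_eq_mul, Complex.star_def, Complex.conj_ofReal,
        Complex.add_re, Complex.re_ofReal_mul, mul_zero, zero_add, ← hz, h2] at h1
      linarith)
    (fun x hx => by
      rw [LinearMap.mem_ker, toLin'_apply] at hx
      refine eq_zero_of_re_star_dotProduct_self_nonpos ?_
      -- The input -εy makes the supply bound -ε‖y‖² + O(ε²), while the left side is 0.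
      set y := C *ᵥ x with hy
      refine nonpos_of_forall_pos_mul_add_sq (b := -(star y ⬝ᵥ D *ᵥ y).re) fun ε hε => ?_
      have h1 := hQ' x (((-ε : ℝ) : ℂ) • y)
      simp only [hker x hx, ← hy, mulVec_smul, dotProduct_add, star_smul,
        smul_dotProduct, dotProduct_smul, smul_eq_mul, Complex.star_def, Complex.conj_ofReal,
        Complex.add_re, Complex.re_ofReal_mul, mul_zero, Complex.zero_re] at h1
      linarith)
  refine PosDef.of_dotProduct_mulVec_pos hH.isHermitian fun x hx => ?_
  refine lt_of_le_of_ne (hH.dotProduct_mulVec_nonneg x) fun h0 => hx ?_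
  have h1 := (hH.dotProduct_mulVec_zero_iff x).1 h0.symm
  have h2 : x ∈ LinearMap.ker (toLin' H) := by simpa using h1
  rwa [hW, Submodule.mem_bot] at h2

end RealizationArray

/-! ### Necessity: the Cayley-transformed system -/

namespace RealizationArray
variable {n m : ℕ}

/-- The map `(x, u) ↦ x - (A x + B u)`. -/
def pastState (R : RealizationArray n m) : (Fin n ⊕ Fin m → ℂ) →ₗ[ℂ] (Fin n → ℂ) :=
  LinearMap.funLeft ℂ ℂ Sum.inl ∘ₗ (LinearMap.id - R.mulVecLin)

/-- The map `(x, u) ↦ x + (A x + B u)`. -/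
def nextState (R : RealizationArray n m) : (Fin n ⊕ Fin m → ℂ) →ₗ[ℂ] (Fin n → ℂ) :=
  LinearMap.funLeft ℂ ℂ Sum.inl ∘ₗ (LinearMap.id + R.mulVecLin)

theorem pastState_apply (R : RealizationArray n m) (v : Fin n ⊕ Fin m → ℂ) :
    pastState R v = v ∘ Sum.inl - (R *ᵥ v) ∘ Sum.inl := rfl

theorem nextState_apply (R : RealizationArray n m) (v : Fin n ⊕ Fin m → ℂ) :
    nextState R v = v ∘ Sum.inl + (R *ᵥ v) ∘ Sum.inl := rfl

theorem mulVec_comp_inl (R : RealizationArray n m) (v : Fin n ⊕ Fin m → ℂ) :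
    (R *ᵥ v) ∘ Sum.inl =
      toBlocks₁₁ R *ᵥ (v ∘ Sum.inl) + toBlocks₁₂ R *ᵥ (v ∘ Sum.inr) := by
  rw [mulVec_eq_elim, Sum.elim_comp_inl]

/-- Zero input shows that (1 + A)(1 - A)⁻¹ = 2(1 - A)⁻¹ - 1 preserves W, hence so does (1 - A)⁻¹. -/
theorem IsControllable.reachable {R : RealizationArray n m}
    (hc : IsControllable (toBlocks₁₁ R) (toBlocks₁₂ R))
    (h1 : IsUnit (1 - toBlocks₁₁ R).det) (W : Submodule ℂ (Fin n → ℂ))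
    (hW : ∀ v, pastState R v ∈ W → nextState R v ∈ W) : W = ⊤ := by
  set A := toBlocks₁₁ R
  set B := toBlocks₁₂ R
  have hcancel : ∀ x, (1 - A) *ᵥ ((1 - A)⁻¹ *ᵥ x) = x := fun x => by
    rw [mulVec_mulVec, mul_nonsing_inv _ h1, one_mulVec]
  have hAinv : ∀ x, A *ᵥ ((1 - A)⁻¹ *ᵥ x) = (1 - A)⁻¹ *ᵥ x - x := fun x => by
    have := hcancel x
    rw [sub_mulVec, one_mulVec] at this
    rw [eq_sub_iff_add_eq, add_comm]
    exact (sub_eq_iff_eq_add.1 this).symm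
  have hhalf : ∀ x : Fin n → ℂ, (2 : ℂ) • x ∈ W → x ∈ W := fun x hx => by
    simpa [smul_smul] using W.smul_mem (2⁻¹ : ℂ) hx
  have hres : ∀ x ∈ W, (1 - A)⁻¹ *ᵥ x ∈ W := fun x hx => by
    have h2 := hW (Sum.elim ((1 - A)⁻¹ *ᵥ x) 0) (by
      rw [pastState_apply, mulVec_comp_inl]
      simpa [A, hAinv] using hx)
    rw [nextState_apply, mulVec_comp_inl] at h2
    simp only [Sum.elim_comp_inl, Sum.elim_comp_inr, mulVec_zero, add_zero] at h2
    refine hhalf _ ?_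
    have h3 := W.add_mem h2 hx
    rw [hAinv] at h3
    convert h3 using 1
    module
  -- An injective endomorphism of the finite-dimensional W is onto, so 1 - A, and with it A,
  -- preserves W.
  have hinj : Function.Injective ((toLin' (1 - A)⁻¹).restrict
      (fun x hx => by simpa using hres x hx : ∀ x ∈ W, toLin' (1 - A)⁻¹ x ∈ W)) := by
    intro x y hxy
    have h2 : (1 - A)⁻¹ *ᵥ (x : Fin n → ℂ) = (1 - A)⁻¹ *ᵥ (y : Fin n → ℂ) := by
      simpa using congrArg Subtype.val hxy
    exact Subtype.ext (by rw [← hcancel x, h2, hcancel])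
  have hAW : ∀ x ∈ W, A *ᵥ x ∈ W := fun x hx => by
    obtain ⟨y, hy⟩ := LinearMap.injective_iff_surjective.1 hinj ⟨x, hx⟩
    have h2 : (1 - A)⁻¹ *ᵥ (y : Fin n → ℂ) = x := by simpa using congrArg Subtype.val hy
    rw [← h2, hAinv, h2]
    exact W.sub_mem hx y.2
  refine hc W hAW fun u => ?_
  -- This pair has past state 0 and next state 2(1 - A)⁻¹Bu.
  have h2 := hW (Sum.elim ((1 - A)⁻¹ *ᵥ (B *ᵥ u)) u) (by
    rw [pastState_apply, mulVec_comp_inl]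
    simp only [Sum.elim_comp_inl, Sum.elim_comp_inr]
    rw [hAinv, sub_add_cancel, sub_self]
    exact W.zero_mem)
  rw [nextState_apply, mulVec_comp_inl] at h2
  simp only [Sum.elim_comp_inl, Sum.elim_comp_inr] at h2
  rw [hAinv, sub_add_cancel, ← two_smul ℂ] at h2
  have h3 := hhalf _ h2
  rw [← hcancel (B *ᵥ u), sub_mulVec, one_mulVec]
  exact W.sub_mem h3 (hAW _ h3)

theorem trajectory_supply_nonneg {R : RealizationArray n m}
    {S : Matrix (Fin n ⊕ Fin m) (Fin n ⊕ Fin m) ℂ}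
    (hA : ∀ s : ℂ, 0 < s.re → (s • (1 : Matrix (Fin n) (Fin n) ℂ) - toBlocks₁₁ R).det ≠ 0)
    (hS : ∀ s : ℂ, 0 < s.re → ∀ x u, s • x = toBlocks₁₁ R *ᵥ x + toBlocks₁₂ R *ᵥ u →
      0 ≤ (star (Sum.elim x u) ⬝ᵥ S *ᵥ Sum.elim x u).re)
    (h0 : ∀ x, (star (Sum.elim x 0) ⬝ᵥ S *ᵥ Sum.elim x 0).re ≤ 0)
    {p : ℕ →₀ (Fin n ⊕ Fin m → ℂ)} (hp : p ∈ trajectories (pastState R) (nextState R)) :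
    0 ≤ (p.sum fun k v => star v ⬝ᵥ S *ᵥ p k).re := by
  set A := toBlocks₁₁ R with hAdef
  have h1 : IsUnit (1 - A).det := isUnit_iff_ne_zero.2 (by simpa using hA 1 (by simp))
  set N := p.support.sup id with hN
  have hsupp : p.support ⊆ Finset.range (N + 1) := Finset.subset_range_sup_succ _
  let y : ℕ → Fin n → ℂ := fun j =>
    (1 - A)⁻¹ *ᵥ ((((1 + A) * (1 - A)⁻¹) ^ j) *ᵥ nextState R (p 0))
  have hcancel : ∀ x, (1 - A) *ᵥ ((1 - A)⁻¹ *ᵥ x) = x := fun x => by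
    rw [mulVec_mulVec, mul_nonsing_inv _ h1, one_mulVec]
  have hpast : ∀ x, pastState R (Sum.elim x 0) = (1 - A) *ᵥ x := fun x => by
    rw [pastState_apply, mulVec_comp_inl, sub_mulVec, one_mulVec]; simp [hAdef]
  have hnext : ∀ x, nextState R (Sum.elim x 0) = (1 + A) *ᵥ x := fun x => by
    rw [nextState_apply, mulVec_comp_inl, add_mulVec, one_mulVec]; simp [hAdef]
  -- Time is turned forward on 0, ..., N, and the trajectory is then continued forever with zero
  -- input.
  let b : ℕ → Fin n ⊕ Fin m → ℂ := fun t =>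
    if t ≤ N then p (N - t) else Sum.elim (y (t - (N + 1))) 0
  have hb0 : pastState R (b 0) = 0 := by
    -- The entry just beyond the support vanishes, so the trajectory starts at rest.
    have h2 : p (N + 1) = 0 := Finsupp.notMem_support_iff.1 fun h => by simpa using hsupp h
    have h3 := hp N
    rw [h2, map_zero] at h3
    simpa [b] using h3
  have hb : ∀ t, pastState R (b (t + 1)) = nextState R (b t) := fun t => by
    rcases lt_trichotomy t N with h | rfl | h
    · simp only [b, if_pos h.le, if_pos (Nat.succ_le_of_lt h)]
      rw [hp, show N - (t + 1) + 1 = N - t by omega]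
    · simp only [b, le_refl, if_true, if_neg (Nat.not_succ_le_self N), hpast]
      simp [y, hcancel]
    · simp only [b, if_neg (not_le.2 h), if_neg (show ¬ t + 1 ≤ N by omega), hpast, hnext]
      rw [show t + 1 - (N + 1) = t - (N + 1) + 1 by omega]
      simp only [y]
      rw [hcancel, pow_succ', mulVec_mulVec, mulVec_mulVec, Matrix.mul_assoc]
  have hsum := sum_supply_nonneg (A := A) (B := toBlocks₁₂ R) hA hS h0
    (x := fun t => b t ∘ Sum.inl) (u := fun t => b t ∘ Sum.inr)
    (by rw [← mulVec_comp_inl]; exact sub_eq_zero.1 hb0)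
    (fun t => by rw [← mulVec_comp_inl, ← mulVec_comp_inl]; exact hb t)
    (N := N + 1) (fun t ht => by
      simp only [b, if_neg (show ¬ t ≤ N by omega), Sum.elim_comp_inr])
  rw [sum_form_eq_range S p p hsupp, ← Finset.sum_range_reflect, Complex.re_sum]
  refine hsum.trans_eq (Finset.sum_congr rfl fun t ht => ?_)
  have ht' : t ≤ N := by have := Finset.mem_range.1 ht; omega
  simp only [Sum.elim_comp_inl_inr]
  simp only [b, if_pos ht', Nat.add_sub_cancel]

theorem exists_quadraticInequality {R : RealizationArray n m}
    (hc : IsControllable (toBlocks₁₁ R) (toBlocks₁₂ R))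
    (hA : ∀ s : ℂ, 0 < s.re → (s • (1 : Matrix (Fin n) (Fin n) ℂ) - toBlocks₁₁ R).det ≠ 0)
    {T : Matrix (Fin m) (Fin m) ℂ} (hT : T.PosSemidef)
    (hF : (transferFunction R).IsHyperPositive T) :
    ∃ H : Matrix (Fin n) (Fin n) ℂ, H.PosSemidef ∧ QuadraticInequality T H R := by
  have hTn := (posSemidef_iff_re hT.isHermitian).1 hT
  have hS := quadraticMatrix_isHermitian hT.isHermitian
    (isHermitian_zero (n := Fin n) (α := ℂ)) R
  have hform := quadraticMatrix_form (T := T) (isHermitian_zero (n := Fin n) (α := ℂ)) R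
  -- Putting H = 0 in the matrix of the inequality leaves exactly the supply rate.
  set S := (weight m (0 : Matrix (Fin n) (Fin n) ℂ) * R + Rᴴ * weight m 0) -
    (gammaMatrix R)ᴴ * fromBlocks T 0 0 T * gammaMatrix R
  simp only [zero_mulVec, dotProduct_zero, Complex.zero_re, mul_zero, sub_zero] at hform
  obtain ⟨H, hH, hdiss⟩ := exists_storage hS (pastState R) (nextState R)
    (fun p hp => trajectory_supply_nonneg hA (fun s hs x u hx => by
        have h1 := (hyperPositive_posSemidef_iff hT.isHermitian _).1 (hF s hs).2 u
        rw [value_mulVec R (hA s hs) x u hx] at h1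
        rw [hform, Sum.elim_comp_inr]
        linarith)
      (fun x => by
        rw [hform, Sum.elim_comp_inr]
        have := hTn ((R *ᵥ Sum.elim x 0) ∘ Sum.inr)
        simp only [star_zero, zero_dotProduct, Complex.zero_re, mul_zero]
        linarith) hp)
    (hc.reachable (isUnit_iff_ne_zero.2 (by simpa using hA 1 (by simp))))
  -- The forms of H at x + x' and x - x' differ by 4 Re x*Hx', twice what the inequality for H
  -- contains.
  have h2H : ((2 : ℂ) • H).PosSemidef := hH.smul (by norm_num)
  refine ⟨(2 : ℂ) • H, h2H, ?_⟩
  rw [quadraticInequality_iff hT.isHermitian h2H.isHermitian]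
  intro v
  have h1 := hdiss v
  rw [hform, nextState_apply, pastState_apply] at h1
  have h2 := re_star_dotProduct_mulVec_comm hH.isHermitian (v ∘ Sum.inl) ((R *ᵥ v) ∘ Sum.inl)
  simp only [star_add, star_sub, add_dotProduct, sub_dotProduct, mulVec_add, mulVec_sub,
    dotProduct_add, dotProduct_sub, Complex.add_re, Complex.sub_re] at h1
  have h3 : (star (v ∘ Sum.inl) ⬝ᵥ ((2 : ℂ) • H) *ᵥ ((R *ᵥ v) ∘ Sum.inl)).re =
      2 * (star (v ∘ Sum.inl) ⬝ᵥ H *ᵥ ((R *ᵥ v) ∘ Sum.inl)).re := by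
    rw [smul_mulVec, dotProduct_smul]; simp
  rw [h3]
  linarith

/-! ### Invertibility and the inverse array -/

/-- If Rv = 0 the inequality reduces to u*Tu ≤ 0, so u = 0; then Ax = 0 and Cx = 0, and
observability gives x = 0. -/
theorem IsObservable.isUnit {A : Matrix (Fin n) (Fin n) ℂ} {B : Matrix (Fin n) (Fin m) ℂ}
    {C : Matrix (Fin m) (Fin n) ℂ} {D : Matrix (Fin m) (Fin m) ℂ} (ho : IsObservable C A)
    {T : Matrix (Fin m) (Fin m) ℂ} {H : Matrix (Fin n) (Fin n) ℂ} (hT : T.PosDef)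
    (hH : H.IsHermitian) (hQ : QuadraticInequality T H (fromBlocks A B C D)) :
    IsUnit (fromBlocks A B C D) := by
  rw [← mulVec_injective_iff_isUnit]
  refine (injective_iff_map_eq_zero (fromBlocks A B C D).mulVecLin).2 fun v hv => ?_
  rw [mulVecLin_apply] at hv
  have h1 := (quadraticInequality_iff hT.isHermitian hH _).1 hQ v
  have e0 : ∀ {k l : Type} (f : k → l), ((0 : l → ℂ) ∘ f) = 0 := fun _ => rfl
  rw [hv, e0, e0] at h1
  simp only [mulVec_zero, dotProduct_zero, Complex.zero_re, mul_zero, zero_add] at h1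
  have hu : v ∘ Sum.inr = 0 := by
    by_contra hu
    exact absurd (posDef_re_pos hT hu) (not_lt.2 h1)
  rw [fromBlocks_mulVec, hu, mulVec_zero, mulVec_zero, add_zero, add_zero] at hv
  have hA : A *ᵥ (v ∘ Sum.inl) = 0 := funext fun i => congrFun hv (Sum.inl i)
  have hC : C *ᵥ (v ∘ Sum.inl) = 0 := funext fun i => congrFun hv (Sum.inr i)
  have hspan := ho (ℂ ∙ (v ∘ Sum.inl)) (fun y hy => by
      obtain ⟨a, rfl⟩ := Submodule.mem_span_singleton.1 hy
      rw [mulVec_smul, hA, smul_zero]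
      exact Submodule.zero_mem _)
    (fun y hy => by
      obtain ⟨a, rfl⟩ := Submodule.mem_span_singleton.1 hy
      rw [mulVec_smul, hC, smul_zero])
  have hx := Submodule.span_singleton_eq_bot.1 hspan
  rw [← Sum.elim_comp_inl_inr v, hx, hu]
  ext i
  rcases i with i | i <;> rfl

/-- Testing R at R⁻¹w exchanges the roles of v and Rv, under which the inequality is symmetric. -/
theorem QuadraticInequality.inv {R : RealizationArray n m} (hR : IsUnit R)
    {T : Matrix (Fin m) (Fin m) ℂ} {H : Matrix (Fin n) (Fin n) ℂ} (hT : T.IsHermitian)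
    (hH : H.IsHermitian) (hQ : QuadraticInequality T H R) : QuadraticInequality T H R⁻¹ := by
  rw [quadraticInequality_iff hT hH] at hQ ⊢
  intro w
  have h1 := hQ (R⁻¹ *ᵥ w)
  rw [mulVec_mulVec, mul_nonsing_inv _ ((isUnit_iff_isUnit_det R).1 hR), one_mulVec,
    re_star_dotProduct_mulVec_comm hH] at h1
  have h2 : (star (w ∘ Sum.inr) ⬝ᵥ ((R⁻¹ *ᵥ w) ∘ Sum.inr)).re =
      (star ((R⁻¹ *ᵥ w) ∘ Sum.inr) ⬝ᵥ (w ∘ Sum.inr)).re := by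
    simpa using re_star_dotProduct_mulVec_comm (isHermitian_one (n := Fin m) (α := ℂ))
      (w ∘ Sum.inr) ((R⁻¹ *ᵥ w) ∘ Sum.inr)
  linarith

end RealizationArray

theorem mainTheorem2 {n m : ℕ} (F : RationalMatrix m)
    (A : Matrix (Fin n) (Fin n) ℂ) (B : Matrix (Fin n) (Fin m) ℂ)
    (C : Matrix (Fin m) (Fin n) ℂ) (D : Matrix (Fin m) (Fin m) ℂ)
    (RF : RealizationArray n m) (hRF : RF = Matrix.fromBlocks A B C D)
    (hF : RealizationArray.IsRealizationOf RF F) :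
    -- (i)
    (∀ T : Matrix (Fin m) (Fin m) ℂ, T.PosSemidef → (1 - T).PosDef →
      ((∃ H : Matrix (Fin n) (Fin n) ℂ,
          H.PosDef ∧ RealizationArray.QuadraticInequality T H RF) → F.IsHyperPositive T) ∧
      (RealizationArray.IsMinimalRealizationOf RF F → F.IsHyperPositive T →
        ∃ H : Matrix (Fin n) (Fin n) ℂ,
          H.PosDef ∧ RealizationArray.QuadraticInequality T H RF)) ∧
    -- (ii) and (iii)
    (∀ (T : Matrix (Fin m) (Fin m) ℂ) (H : Matrix (Fin n) (Fin n) ℂ),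
      T.PosDef → (1 - T).PosDef → H.PosDef → RealizationArray.QuadraticInequality T H RF →
      RealizationArray.IsMinimalRealizationOf RF F →
        IsUnit RF ∧
        RealizationArray.QuadraticInequality T H RF⁻¹ ∧
        ∀ Fhat : RationalMatrix m,
          RealizationArray.IsRealizationOf RF⁻¹ Fhat → Fhat.IsHyperPositive T) := by
  subst hRF
  refine ⟨fun T hT _ => ⟨?_, fun hmin hHP => ?_⟩, fun T H hT _ hH hQ hmin => ?_⟩
  · rintro ⟨H, hH, hQ⟩
    rw [hF]
    exact hQ.isHyperPositive hT hH
  · rw [hF] at hHP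
    have hc := hmin.isControllable
    have ho := hmin.isObservable
    obtain ⟨H, hH, hQ⟩ := RealizationArray.exists_quadraticInequality (by simpa using hc)
      (fun s hs => by
        simpa using hc.det_ne_zero_of_analyticAtPoint ho (hHP s hs).1) hT hHP
    exact ⟨H, ho.posDef hT hH hQ, hQ⟩
  · have hunit := hmin.isObservable.isUnit hT hH.isHermitian hQ
    have hinv := hQ.inv hunit hT.isHermitian hH.isHermitian
    refine ⟨hunit, hinv, fun Fhat hFhat => ?_⟩
    rw [hFhat]
    exact hinv.isHyperPositive hT.posSemidef hH
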